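/- Let $G$ be a diffeological group which is a Lie group modelled on a convenient vector space $E$, i.e. a $D$-open neighbourhood of $1\in G$ is diffeomorphic to a $D$-open subset of $E$ (finite-dimensional, Banach, Fréchet–Lie groups, loop groups and current groups are examples). Let $\sigma:\mathbb Z_2\to\operatorname{Aut}(G)$ be an action by smooth automorphisms, $H_\sigma=G\rtimes_\sigma\mathbb Z_2$ with $\mathbb Z_2$ discrete, and $\mathfrak h_\sigma=\operatorname{Lie}(H_\sigma)=\operatorname{Lie}(G)\cong E$. Let $\pi:Q\to X$ be a diffeological principal $H_\sigma$-bundle (right action) over a diffeological space $X$. Differential forms on diffeological spaces are defined plotwise. Let $P$ be a symmetric smooth $r$-linear form on $\mathfrak h_\sigma$, invariant under the adjoint action of $H_\sigma$. Consider any locally finite $D$-open cover $(U_i)_{i\in I}$ of $X$ with smooth local sections $s_i:U_i\to Q$ and a smooth partition of unity $(\lambda_i)$ subordinate to it (in particular $\operatorname{supp}\lambda_i\subset U_i$). Define the transition functions $h_{ki}:U_k\cap U_i\to H_\sigma$ by $s_k=s_i\,h_{ki}$, and put $$A_k=\sum_i\lambda_i\,h_{ki}^{-1}dh_{ki},\qquad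 F_k=dA_k+\tfrac12[A_k,A_k]\qquad\text{on }U_k .$$ 1. There is a principal connection form $\Theta$ on $Q$ (the barycentric connection) with $s_k^*\Theta=A_k$ for all $k$. 2. There is a unique differential form $\eta$ of degree $2r$ on $X$ with $\eta|_{U_k}=P(F_k,\dots,F_k)$ for all $k$, and $d\eta=0$. 3. More generally, for every principal connection form $\Theta$ on $Q$ and every $D$-open cover $(U_k)$ of $X$ with smooth local sections $s_k$ of $Q$, set $A_k=s_k^*\Theta$ and $F_k=dA_k+\frac12[A_k,A_k]$. Then there is a unique differential form $\eta$ of degree $2r$ on $X$ with $\eta|_{U_k}=P(F_k,\dots,F_k)$ for all $k$, and $d\eta=0$. 4. The de Rham class $[\eta]\in H^{2r}_{\mathrm{dR}}(X)$ is the same for all the choices in 2 and 3: it depends neither on the cover, the local sections and the partition of unity, nor on the connection. -/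

import Mathlib

open Diffeology ContDiff Topology

namespace BaryChernWeil

/-- Parameter domains of plots. -/
abbrev Euc (m : ℕ) : Type := EuclideanSpace ℝ (Fin m)

section Diffeologies

/-- Smoothness of a map on a (D-open) subset `U`, for the subset diffeology: plots with values in
`U` are sent to plots. -/
def SmoothOn {X Y : Type*} [DiffeologicalSpace X] [DiffeologicalSpace Y]
    (f : X → Y) (U : Set X) : Prop :=
  ∀ (m : ℕ) (p : Euc m → X), IsPlot p → (∀ x, p x ∈ U) → IsPlot (f ∘ p)

/-- Diffeological groups: multiplication and inversion are smooth. -/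
class DiffeologicalGroup (H : Type*) [Group H] [DiffeologicalSpace H] : Prop where
  mul_plot : ∀ {m : ℕ} {p q : Euc m → H}, IsPlot p → IsPlot q → IsPlot (fun x => p x * q x)
  inv_plot : ∀ {m : ℕ} {p : Euc m → H}, IsPlot p → IsPlot (fun x => (p x)⁻¹)

/-- The group of two elements `ℤˣ = {1, -1}` being discrete, `G ⋊[σ] ℤˣ` carries the product
diffeology: the `G`-component of a plot is a plot, its sign component is locally constant. -/
instance semidirectDiffeology {G : Type*} [Group G] [DiffeologicalSpace G]
    (σ : ℤˣ →* MulAut G) : DiffeologicalSpace (G ⋊[σ] ℤˣ) where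
  plots m := {p | IsPlot (fun x : Euc m => (p x).left) ∧ IsLocallyConstant fun x => (p x).right}
  constant_plots h := ⟨isPlot_const, IsLocallyConstant.const _⟩
  plot_reparam {n m p f} hp hf :=
    ⟨isPlot_reparam (p := fun x => (p x).left) hp.1 hf, hp.2.comp_continuous hf.continuous⟩
  locality {n p} hp := by
    refine ⟨DiffeologicalSpace.locality fun x => ?_, ?_⟩
    · obtain ⟨u, hu, hxu, h⟩ := hp x
      exact ⟨u, hu, hxu, fun hf hf' => (h hf hf').1⟩
    · rw [IsLocallyConstant.iff_exists_open]
      intro x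
      obtain ⟨u, hu, hxu, h⟩ := hp x
      obtain ⟨ε, hε, hε'⟩ := Metric.isOpen_iff.mp hu x hxu
      let e : OpenPartialHomeomorph (Euc n) (Euc n) := OpenPartialHomeomorph.univBall x ε
      have ht : e.target = Metric.ball x ε := OpenPartialHomeomorph.univBall_target x hε
      have hs : e.source = Set.univ := OpenPartialHomeomorph.univBall_source x ε
      have hmem : ∀ y, e y ∈ u := fun y => hε' (by
        rw [← ht]; exact e.map_source (by rw [hs]; trivial))
      have hc := (h (f := e) hmem OpenPartialHomeomorph.contDiff_univBall).2
      refine ⟨Metric.ball x ε, Metric.isOpen_ball, Metric.mem_ball_self hε, fun y hy => ?_⟩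
      have key := hc.apply_eq_of_isPreconnected (isPreconnected_univ)
        (Set.mem_univ (e.symm y)) (Set.mem_univ (e.symm x))
      simpa [Function.comp, e.right_inv (ht ▸ hy),
        e.right_inv (ht ▸ Metric.mem_ball_self hε : x ∈ e.target)] using key

end Diffeologies

section Calculus

/-- Convenient vector spaces: real vector spaces with a diffeology such that
smooth linear functionals separate points and detect plots, and scalarwise smooth curves have
derivatives. All finite-dimensional, Banach and Fréchet spaces are of this kind. -/
class ConvenientSpace (E : Type*) [AddCommGroup E] [Module ℝ E] [DiffeologicalSpace E] :
    Prop where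
  separated : ∀ v : E, v ≠ 0 → ∃ ℓ : E →ₗ[ℝ] ℝ, DSmooth ℓ ∧ ℓ v ≠ 0
  plot_of_scalarwise : ∀ {m : ℕ} (p : Euc m → E),
    (∀ ℓ : E →ₗ[ℝ] ℝ, DSmooth ℓ → ContDiff ℝ ∞ fun x => ℓ (p x)) → IsPlot p
  exists_deriv : ∀ c : ℝ → E,
    (∀ ℓ : E →ₗ[ℝ] ℝ, DSmooth ℓ → ContDiff ℝ ∞ fun t => ℓ (c t)) →
    ∃ v : E, ∀ ℓ : E →ₗ[ℝ] ℝ, DSmooth ℓ → HasDerivAt (fun t => ℓ (c t)) (ℓ v) 0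

open Classical in
/-- The derivative at `0` of a curve in a convenient vector space (`0` if there is none). -/
noncomputable def curveDeriv {E : Type*} [AddCommGroup E] [Module ℝ E] [DiffeologicalSpace E]
    (c : ℝ → E) : E :=
  if h : ∃ v : E, ∀ ℓ : E →ₗ[ℝ] ℝ, DSmooth ℓ → HasDerivAt (fun t => ℓ (c t)) (ℓ v) 0
  then h.choose else 0

end Calculus

section LieGroups

variable {H E : Type*} [Group H] [DiffeologicalSpace H]
  [AddCommGroup E] [Module ℝ E] [DiffeologicalSpace E]

/-- A chart at the identity: a diffeomorphism from a D-open neighbourhood of `1` in `H` onto a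
D-open subset of `E`. A diffeological group with such a chart, `E` convenient, is a Lie group
modelled on `E`; its Lie algebra `T₁H` is identified with `E` by the differential of the chart. -/
structure LieChart (H E : Type*) [Group H] [DiffeologicalSpace H]
    [AddCommGroup E] [Module ℝ E] [DiffeologicalSpace E] extends PartialEquiv H E where
  open_source : IsOpen[dTopology] source
  open_target : IsOpen[dTopology] target
  one_mem : (1 : H) ∈ source
  smooth_toFun : SmoothOn toFun source
  smooth_invFun : SmoothOn invFun target

/-- The chart of `G ⋊[σ] ℤˣ` given by a chart of its open subgroup `G`; in particular both
groups have the same Lie algebra. -/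
def LieChart.semidirect {G : Type*} [Group G] [DiffeologicalSpace G] (φ : LieChart G E)
    (σ : ℤˣ →* MulAut G) : LieChart (G ⋊[σ] ℤˣ) E where
  toFun h := φ.toFun h.left
  invFun v := ⟨φ.invFun v, 1⟩
  source := {h | h.left ∈ φ.source ∧ h.right = 1}
  target := φ.target
  map_source' h hh := φ.map_source' hh.1
  map_target' v hv := ⟨φ.map_target' hv, rfl⟩
  left_inv' h hh := SemidirectProduct.ext (φ.left_inv' hh.1) hh.2.symm
  right_inv' v hv := φ.right_inv' hv
  open_source := by
    rw [isOpen_iff_preimages_plots]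
    intro n p hp
    exact (isOpen_iff_preimages_plots.1 φ.open_source n _ hp.1).inter (hp.2.isOpen_fiber 1)
  open_target := φ.open_target
  one_mem := ⟨φ.one_mem, rfl⟩
  smooth_toFun m p hp hU := φ.smooth_toFun m (fun x => (p x).left) hp.1 fun x => (hU x).1
  smooth_invFun m p hp hU := ⟨φ.smooth_invFun m p hp hU, IsLocallyConstant.const _⟩

namespace LieChart

variable (φ : LieChart H E)

/-- The curve in `H` through `1` with initial velocity `ξ` that is straight in the chart. -/
def curve (ξ : E) (t : ℝ) : H := φ.invFun (φ.toFun 1 + t • ξ)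

/-- The adjoint action: the velocity at `1` of `t ↦ h c(t) h⁻¹`, where `c` is a curve through `1`
with velocity `ξ`. -/
noncomputable def Ad (h : H) (ξ : E) : E :=
  curveDeriv fun t => φ.toFun (h * φ.curve ξ t * h⁻¹)

/-- The Lie bracket: the derivative of the adjoint action. -/
noncomputable def bracket (ξ η : E) : E := curveDeriv fun t => φ.Ad (φ.curve ξ t) η

/-- `h⁻¹dh`, i.e. the pull-back by `h` of the left Maurer-Cartan form, evaluated at the
vector `v` based at `x`. Only the values of `h` near `x` matter. -/
noncomputable def logDeriv {m : ℕ} (h : Euc m → H) (x v : Euc m) : E :=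
  curveDeriv fun t => φ.toFun ((h x)⁻¹ * h (x + t • v))

/-- The curvature `F = dA + ½[A,A]` of a Lie algebra valued `1`-form `A` on `Euc m`:
`F(v,w) = ∂_v A(w) - ∂_w A(v) + [A(v),A(w)]`, since `½[A,A](v,w) = [A(v),A(w)]`. -/
noncomputable def curvature {m : ℕ} (A : Euc m → Euc m → E) (x v w : Euc m) : E :=
  curveDeriv (fun t : ℝ => A (x + t • v) w) - curveDeriv (fun t : ℝ => A (x + t • w) v)
    + φ.bracket (A x v) (A x w)

/-- Invariant polynomials, homogeneous of degree `r`, on the Lie algebra: symmetric, smooth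
`r`-linear forms which are invariant under the adjoint action of `H`. -/
structure IsInvariantPolynomial {r : ℕ} (P : MultilinearMap ℝ (fun _ : Fin r => E) ℝ) :
    Prop where
  symm : ∀ (τ : Equiv.Perm (Fin r)) (v : Fin r → E), P (fun j => v (τ j)) = P v
  smooth : ∀ {m : ℕ} (f : Fin r → Euc m → E), (∀ j, IsPlot (f j)) →
    ContDiff ℝ ∞ fun x => P fun j => f j x
  invariant : ∀ (h : H) (v : Fin r → E), P (fun j => φ.Ad h (v j)) = P v

end LieChart

/-- `P(F,…,F)` for a Lie algebra valued `2`-form `F`, evaluated at `2r` vectors; the products are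
wedge products, `(α ∧ β)(v) = 1/(a! b!) ∑_τ sgn(τ) α(v_τ) β(v_τ)` in degrees `a` and `b`. -/
noncomputable def polyForm {V : Type*} {r : ℕ} (P : MultilinearMap ℝ (fun _ : Fin r => E) ℝ)
    (F : V → V → E) (v : Fin (2 * r) → V) : ℝ :=
  (1 / 2 : ℝ) ^ r * ∑ τ : Equiv.Perm (Fin (2 * r)), ((Equiv.Perm.sign τ : ℤ) : ℝ) *
    P fun j : Fin r => F (v (τ ⟨2 * (j : ℕ), by omega⟩)) (v (τ ⟨2 * (j : ℕ) + 1, by omega⟩))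

end LieGroups

section Forms

/-- Plots of `X` with domain `Euc m`. -/
abbrev Plot (X : Type*) [DiffeologicalSpace X] (m : ℕ) : Type _ := {p : Euc m → X // IsPlot p}

/-- Differential `n`-forms on a diffeological space: a smooth `n`-form for each plot, compatible
with smooth reparametrisations. -/
def dFormSubmodule (X : Type*) [DiffeologicalSpace X] (n : ℕ) :
    Submodule ℝ ((m : ℕ) → Plot X m → Euc m → Euc m [⋀^Fin n]→L[ℝ] ℝ) where
  carrier := {α | (∀ m p, ContDiff ℝ ∞ (α m p)) ∧
    ∀ (m k : ℕ) (p : Plot X m) (f : Euc k → Euc m) (hf : ContDiff ℝ ∞ f),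
      α k ⟨p.1 ∘ f, isPlot_reparam p.2 hf⟩ =
        fun x => (α m p (f x)).compContinuousLinearMap (fderiv ℝ f x)}
  add_mem' {a b} ha hb := by
    refine ⟨fun m p => (ha.1 m p).add (hb.1 m p), fun m k p f hf => ?_⟩
    funext x
    ext v
    simp [ha.2 m k p f hf, hb.2 m k p f hf]
  zero_mem' := by
    refine ⟨fun m p => contDiff_const, fun m k p f hf => ?_⟩
    funext x
    ext v
    simp
  smul_mem' c a ha := by
    refine ⟨fun m p => (ha.1 m p).const_smul c, fun m k p f hf => ?_⟩
    funext x
    ext v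
    simp [ha.2 m k p f hf]

/-- The type of differential `n`-forms on a diffeological space, a real vector space. -/
def DForm (X : Type*) [DiffeologicalSpace X] (n : ℕ) : Type _ := dFormSubmodule X n

noncomputable instance (X : Type*) [DiffeologicalSpace X] (n : ℕ) : AddCommGroup (DForm X n) :=
  inferInstanceAs (AddCommGroup (dFormSubmodule X n))

noncomputable instance (X : Type*) [DiffeologicalSpace X] (n : ℕ) : Module ℝ (DForm X n) :=
  inferInstanceAs (Module ℝ (dFormSubmodule X n))

variable (X : Type*) [DiffeologicalSpace X]

theorem DForm.differentiable {X : Type*} [DiffeologicalSpace X] {n : ℕ} (α : DForm X n)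
    (m : ℕ) (p : Plot X m) : Differentiable ℝ (α.1 m p) :=
  (α.2.1 m p).differentiable (by simp)

/-- The exterior derivative, computed in plots. -/
noncomputable def extD (n : ℕ) : DForm X n →ₗ[ℝ] DForm X (n + 1) where
  toFun α := ⟨fun m p => extDeriv (α.1 m p), by
    constructor
    · intro m p
      have h : ContDiff ℝ ∞ (fderiv ℝ (α.1 m p)) := (α.2.1 m p).fderiv_right (by simp)
      exact (ContinuousAlternatingMap.alternatizeUncurryFinCLM ℝ (Euc m) ℝ).contDiff.comp h
    · intro m k p f hf
      funext x
      change extDeriv (α.1 k ⟨p.1 ∘ f, isPlot_reparam p.2 hf⟩) x = _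
      rw [α.2.2 m k p f hf]
      exact extDeriv_pullback (r := ∞) (DForm.differentiable α m p _) hf.contDiffAt
        (by
          rw [minSmoothness_of_isRCLikeNormedField]
          exact WithTop.coe_le_coe.2 (le_top (a := (2 : ℕ∞))))⟩
  map_add' a b := Subtype.ext <| funext fun m => funext fun p => funext fun x =>
    extDeriv_add (DForm.differentiable a m p x) (DForm.differentiable b m p x)
  map_smul' c a := Subtype.ext <| funext fun m => funext fun p => funext fun x =>
    extDeriv_smul c _

/-- Closed forms. -/
noncomputable def closedForms (n : ℕ) : Submodule ℝ (DForm X n) := LinearMap.ker (extD X n)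

/-- Exact forms; only `0` is exact in degree `0`. -/
noncomputable def exactForms : (n : ℕ) → Submodule ℝ (DForm X n)
  | 0 => ⊥
  | n + 1 => LinearMap.range (extD X n)

/-- De Rham cohomology: closed forms modulo exact forms. -/
abbrev DeRham (n : ℕ) : Type _ :=
  closedForms X n ⧸ (exactForms X n).comap (closedForms X n).subtype

/-- The de Rham class of a closed form. -/
noncomputable def deRhamClass {X : Type*} [DiffeologicalSpace X] {n : ℕ} (η : closedForms X n) :
    DeRham X n :=
  Submodule.Quotient.mk η

end Forms

section Bundles

open MulOpposite

variable {X Q : Type*} [DiffeologicalSpace X] [DiffeologicalSpace Q]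

/-- Diffeological principal bundles, for a right action of `H` on the total space `Q`: the action
is smooth, free, transitive on the fibres of the smooth projection `π`, the map
`(q, h) ↦ (q, qh)` has smooth inverse on `Q ×_X Q`, and plots of the base lift locally. -/
structure IsPrincipalBundle (H : Type*) [Group H] [DiffeologicalSpace H]
    [MulAction Hᵐᵒᵖ Q] (π : Q → X) : Prop where
  smooth_proj : DSmooth π
  smooth_act : ∀ {m : ℕ} {q : Euc m → Q} {h : Euc m → H}, IsPlot q → IsPlot h →
    IsPlot fun x => op (h x) • q x
  fibre : ∀ q q' : Q, π q = π q' ↔ ∃ h : H, q' = op h • q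
  free : ∀ (q : Q) (h : H), op h • q = q → h = 1
  smooth_div : ∀ {m : ℕ} {q : Euc m → Q} {h : Euc m → H}, IsPlot q →
    IsPlot (fun x => op (h x) • q x) → IsPlot h
  lift : ∀ {m : ℕ} (p : Euc m → X), IsPlot p → ∀ x, ∃ q : Euc m → Q, IsPlot q ∧
    ∀ᶠ y in 𝓝 x, π (q y) = p y

/-- A family of local sections over a D-open cover (equivalently, of local trivialisations). -/
structure LocalSections (π : Q → X) (ι : Type*) where
  U : ι → Set X
  sec : ι → X → Q
  isOpen_U : ∀ i, IsOpen[dTopology] (U i)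
  cover : ∀ x, ∃ i, x ∈ U i
  smooth_sec : ∀ i, SmoothOn (sec i) (U i)
  proj_sec : ∀ i, ∀ x ∈ U i, π (sec i x) = x

/-- The data of a D-numerable bundle: local sections over a locally finite D-open cover, and a
smooth partition of unity subordinate to it. -/
structure NumerableSections (π : Q → X) (ι : Type*) extends LocalSections π ι where
  locallyFinite : @LocallyFinite ι X dTopology U
  lam : ι → X → ℝ
  smooth_lam : ∀ i, DSmooth (lam i)
  lam_nonneg : ∀ i x, 0 ≤ lam i x
  lam_sum : ∀ x, ∑ᶠ i, lam i x = 1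
  lam_supp : ∀ i, @closure X dTopology (Function.support (lam i)) ⊆ U i

section

variable {H E : Type*} [Group H] [DiffeologicalSpace H] [MulAction Hᵐᵒᵖ Q]
  [AddCommGroup E] [Module ℝ E] [DiffeologicalSpace E]

/-- The element `h` with `q' = qh`, for `q`, `q'` in the same fibre. -/
noncomputable def transition (H : Type*) [Group H] [MulAction Hᵐᵒᵖ Q] (q q' : Q) : H :=
  Classical.epsilon fun h => q' = op h • q

/-- The barycentric local form `A_k = ∑_i λ_i h_ki⁻¹dh_ki` on `U_k`, in the plot `p`, where the
transition function `h_ki` is given by `s_k = s_i h_ki` on `U_k ∩ U_i`. The terms with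
`λ_i = 0` vanish, in particular those at points outside `U_i`. -/
noncomputable def baryForm (φ : LieChart H E) {π : Q → X} {ι : Type*}
    (T : NumerableSections π ι) (k : ι) {m : ℕ} (p : Euc m → X) (x v : Euc m) : E :=
  ∑ᶠ i, T.lam i (p x) •
    φ.logDeriv (fun y => transition H (T.sec i (p y)) (T.sec k (p y))) x v

/-- Principal connection forms on `Q`: Lie algebra valued smooth `1`-forms on `Q` with
`(qh)^*Θ = Ad(h⁻¹) q^*Θ + h⁻¹dh`. For constant `h` this is equivariance, for constant `q` it says
that `Θ` restricts to the Maurer-Cartan form on the orbits. -/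
structure Connection (φ : LieChart H E) (Q : Type*) [DiffeologicalSpace Q]
    [MulAction Hᵐᵒᵖ Q] where
  form : (m : ℕ) → Plot Q m → Euc m → Euc m → E
  linear : ∀ m q x, IsLinearMap ℝ (form m q x)
  smooth : ∀ m q v, IsPlot fun x => form m q x v
  pullback : ∀ (m k : ℕ) (q : Plot Q m) (f : Euc k → Euc m) (hf : ContDiff ℝ ∞ f)
    (x v : Euc k), form k ⟨q.1 ∘ f, isPlot_reparam q.2 hf⟩ x v = form m q (f x) (fderiv ℝ f x v)
  gauge : ∀ (m : ℕ) (q : Plot Q m) (h : Euc m → H), IsPlot h →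
    ∀ (hq : IsPlot fun y => op (h y) • q.1 y) (x v : Euc m),
      form m ⟨fun y => op (h y) • q.1 y, hq⟩ x v =
        φ.Ad (h x)⁻¹ (form m q x v) + φ.logDeriv h x v

/-- The local form `A_k = s_k^*Θ` on `U_k`, in a plot `p` of `U_k`. -/
def Connection.localForm {φ : LieChart H E} (Θ : Connection φ Q) {π : Q → X} {ι : Type*}
    (S : LocalSections π ι) (k : ι) {m : ℕ} (p : Euc m → X) (hp : IsPlot p)
    (hU : ∀ x, p x ∈ S.U k) : Euc m → Euc m → E :=
  Θ.form m ⟨S.sec k ∘ p, S.smooth_sec k m p hp hU⟩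

/-- The global form `η` restricts on each `U_k` to `P(F_k,…,F_k)`, where `F_k = dA_k + ½[A_k,A_k]`,
for the local forms `A_k` of the connection `Θ`. -/
def GluesConnection (φ : LieChart H E) {r : ℕ} (P : MultilinearMap ℝ (fun _ : Fin r => E) ℝ)
    {π : Q → X} {ι : Type*} (S : LocalSections π ι) (Θ : Connection φ Q)
    (η : DForm X (2 * r)) : Prop :=
  ∀ (k : ι) (m : ℕ) (p : Euc m → X) (hp : IsPlot p) (hU : ∀ x, p x ∈ S.U k) (x : Euc m)
    (v : Fin (2 * r) → Euc m),
    η.1 m ⟨p, hp⟩ x v = polyForm P (φ.curvature (Θ.localForm S k p hp hU) x) v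

/-- The global form `η` restricts on each `U_k` to `P(F_k,…,F_k)`, where `F_k = dA_k + ½[A_k,A_k]`,
for the barycentric local forms `A_k`. -/
def GluesBary (φ : LieChart H E) {r : ℕ} (P : MultilinearMap ℝ (fun _ : Fin r => E) ℝ)
    {π : Q → X} {ι : Type*} (T : NumerableSections π ι) (η : DForm X (2 * r)) : Prop :=
  ∀ (k : ι) (m : ℕ) (p : Euc m → X) (hp : IsPlot p), (∀ x, p x ∈ T.U k) → ∀ (x : Euc m)
    (v : Fin (2 * r) → Euc m),
    η.1 m ⟨p, hp⟩ x v = polyForm P (φ.curvature (baryForm φ T k p) x) v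

end

end Bundles

end BaryChernWeil

set_option linter.unusedSectionVars false

namespace BaryChernWeil

/-! ### Parameter integrals over the unit interval and Hadamard's lemma. -/

section Integrals

variable {V F : Type*} [NormedAddCommGroup V] [NormedSpace ℝ V] [FiniteDimensional ℝ V]
  [NormedAddCommGroup F] [NormedSpace ℝ F] [CompleteSpace F]

/-! This is Chern–Weil theory carried out plot by plot. Given a plot `p` of the base and a point
`x`, lift `p` near `x` to a plot `q` of the total space and evaluate `P` on the curvature of the
connection form along `q`. Two lifts differ near `x` by a smooth map `k` into the group, so the
connection form changes from `A` to `Ad(k⁻¹)A + k⁻¹dk`. By the Maurer–Cartan equation the curvature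
changes only by `Ad(k⁻¹)` (`curv_gauge`, `exists_curv_eq_Ad`), and invariance of `P` makes the value
independent of the lift (`chernWeilPlot_apply`). That independence gives smoothness, compatibility
with reparametrisations and, taking `q = s_k ∘ p`, the formula on each `U_k`. Uniqueness holds
because every plot lies locally in some `U_k`.

Closedness uses the same freedom: at a given point the lift can be gauged so that `A` vanishes there
(`exists_lift_form_eq_zero`). At such a point the Bianchi identity reduces to the symmetry of second
derivatives, with no Jacobi identity and no covariant derivative, and grouping permutations by
3-cycles turns it into `d P(F,…,F) = 0` (`sum_polyForm_deriv_eq_zero`).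

Two connections are joined by an affine path, which is itself a connection on the cylinder over the
bundle. Its Chern–Weil form is closed and restricts to the two given forms at times 0 and 1, so
integrating over the interval produces a primitive of their difference (`extDeriv_fibreIntegral`,
`chernWeil_sub_mem_exactForms`). The barycentric form comes from an actual connection: the average,
with weights `λ_i`, of the flat connections attached to the local sections. It satisfies the gauge
rule because the weights sum to 1. The barycentric statement is thus a case of the general one.

Two devices support this. Calculus in the convenient space is tested on smooth linear functionals
(`SmAt.apply_dirDeriv`). The Lie theory uses no exponential map, only velocities at the identity: a
chain rule (`dirDeriv_eq_diff`) and the bracket as an antisymmetrised mixed second derivative of the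
product (`bracket_dirDeriv`). Since plots are defined on all of `Euc m`, localisation means
precomposing with a smooth self-map that is the identity near a point and has small range
(`exists_contDiff_eventuallyEq_id`). -/

theorem hasFDerivAt_integral_unitInterval {f : V × ℝ → F} (hf : ContDiff ℝ 1 f) (x : V) :
    HasFDerivAt (fun x => ∫ t in (0 : ℝ)..1, f (x, t))
      (∫ t in (0 : ℝ)..1, (fderiv ℝ f (x, t)).comp (ContinuousLinearMap.inl ℝ V ℝ)) x := by
  have hf' : Continuous fun z : V × ℝ =>
      (fderiv ℝ f z).comp (ContinuousLinearMap.inl ℝ V ℝ) :=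
    (hf.continuous_fderiv (by simp)).clm_comp continuous_const
  -- Compactness of ball times interval makes a constant the dominating function.
  obtain ⟨C, hC⟩ := ((isCompact_closedBall x 1).prod (isCompact_Icc (a := (0 : ℝ)) (b := 1)))
    |>.exists_bound_of_continuousOn hf'.continuousOn
  refine (intervalIntegral.hasFDerivAt_integral_of_dominated_of_fderiv_le
    (μ := MeasureTheory.volume) (F := fun x t => f (x, t))
    (F' := fun x t => (fderiv ℝ f (x, t)).comp (ContinuousLinearMap.inl ℝ V ℝ))
    (bound := fun _ => C) (Metric.ball_mem_nhds x one_pos) ?_ ?_ ?_ ?_ ?_ ?_)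
  · exact Filter.Eventually.of_forall fun y =>
      (hf.continuous.comp (by fun_prop)).aestronglyMeasurable
  · exact (hf.continuous.comp (by fun_prop)).intervalIntegrable _ _
  · exact (hf'.comp (by fun_prop : Continuous fun t : ℝ => (x, t))).aestronglyMeasurable
  · refine Filter.Eventually.of_forall fun t ht y hy => hC (y, t) ⟨Metric.ball_subset_closedBall hy, ?_⟩
    rw [Set.uIoc_of_le zero_le_one] at ht
    exact ⟨ht.1.le, ht.2⟩
  · exact continuous_const.intervalIntegrable _ _
  · refine Filter.Eventually.of_forall fun t _ y _ => ?_
    have h1 := (hf.differentiable (by simp) (y, t)).hasFDerivAt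
    exact h1.comp y ((hasFDerivAt_prodMk_left y t))

theorem contDiff_integral_unitInterval {f : V × ℝ → F} (hf : ContDiff ℝ ∞ f) :
    ContDiff ℝ ∞ fun x => ∫ t in (0 : ℝ)..1, f (x, t) := by
  -- The induction must range over all integrands: each directional derivative of the integral is
  -- again such an integral, with integrand `∂_v f`.
  have key : ∀ n : ℕ, ∀ f : V × ℝ → F, ContDiff ℝ ∞ f →
      ContDiff ℝ n fun x => ∫ t in (0 : ℝ)..1, f (x, t) := by
    intro n
    induction n with
    | zero =>
      intro f hf
      have h (x : V) := hasFDerivAt_integral_unitInterval (hf.of_le (by simp)) x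
      exact contDiff_zero.2 (continuous_iff_continuousAt.2 fun x => (h x).continuousAt)
    | succ n ih =>
      intro f hf
      have h (x : V) := hasFDerivAt_integral_unitInterval (hf.of_le (by simp)) x
      have hc : Continuous fun z : V × ℝ =>
          (fderiv ℝ f z).comp (ContinuousLinearMap.inl ℝ V ℝ) :=
        (hf.continuous_fderiv (by simp)).clm_comp continuous_const
      push_cast
      refine contDiff_succ_iff_fderiv_apply.2 ⟨fun x => (h x).differentiableAt, by simp, fun v => ?_⟩
      have : (fun x => fderiv ℝ (fun x => ∫ t in (0 : ℝ)..1, f (x, t)) x v) =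
          fun x => ∫ t in (0 : ℝ)..1, fderiv ℝ f (x, t) (v, 0) := by
        funext x
        rw [(h x).fderiv, ContinuousLinearMap.intervalIntegral_apply]
        · simp
        · exact (hc.comp (by fun_prop : Continuous fun t : ℝ => (x, t))).intervalIntegrable _ _
      rw [this]
      exact ih (fun z => fderiv ℝ f z (v, 0)) ((hf.fderiv_right (by simp)).clm_apply contDiff_const)
  exact contDiff_infty.2 fun n => key n f hf

/-- Hadamard's lemma for smooth curves. -/
theorem exists_contDiff_eq_add_smul {c : ℝ → F} (hc : ContDiff ℝ ∞ c) :
    ∃ e : ℝ → F, ContDiff ℝ ∞ e ∧ (∀ t, c t = c 0 + t • e t) ∧ e 0 = deriv c 0 := by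
  have hd : ContDiff ℝ ∞ (deriv c) := (contDiff_infty_iff_deriv.1 hc).2
  -- The quotient is `e(t) = ∫₀¹ c'(ts) ds`, from integrating the `s`-derivative of `c(ts)`.
  refine ⟨fun t => ∫ s in (0 : ℝ)..1, deriv c (t * s), ?_, fun t => ?_, by simp⟩
  · exact contDiff_integral_unitInterval (f := fun z : ℝ × ℝ => deriv c (z.1 * z.2))
      (hd.comp (by fun_prop))
  · have h1 : ∀ s ∈ Set.uIcc (0 : ℝ) 1, HasDerivAt (fun s => c (t * s)) (t • deriv c (t * s)) s := by
      intro s _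
      have := ((hc.differentiable (by simp)) (t * s)).hasDerivAt.scomp s
        ((hasDerivAt_id s).const_mul t)
      simpa [Function.comp_def] using this
    have h2 := intervalIntegral.integral_eq_sub_of_hasDerivAt h1
      (((hd.continuous.comp (by fun_prop)).const_smul t).intervalIntegrable _ _)
    rw [intervalIntegral.integral_smul] at h2
    rw [h2]; simp

end Integrals

/-! ### Smooth maps and germs of smooth maps into diffeological spaces. -/

section Smooth

variable {V W X Y : Type*} [NormedAddCommGroup V] [NormedSpace ℝ V]
  [NormedAddCommGroup W] [NormedSpace ℝ W]
  [DiffeologicalSpace X] [DiffeologicalSpace Y]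

/-- Smooth maps from a normed space to a diffeological space. -/
def Sm (f : V → X) : Prop := ∀ (m : ℕ) (g : Euc m → V), ContDiff ℝ ∞ g → IsPlot (f ∘ g)

/-- Smoothness near a point: agreement with a smooth map near that point. -/
def SmAt (f : V → X) (x : V) : Prop := ∃ f' : V → X, Sm f' ∧ f' =ᶠ[𝓝 x] f

theorem Sm.smAt {f : V → X} (hf : Sm f) (x : V) : SmAt f x := ⟨f, hf, .rfl⟩

theorem sm_iff_isPlot {m : ℕ} {p : Euc m → X} : Sm p ↔ IsPlot p :=
  ⟨fun h => h m id contDiff_id, fun h _ _ hg => isPlot_reparam h hg⟩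

theorem sm_const (a : X) : Sm fun _ : V => a := fun _ _ _ => isPlot_const

theorem Sm.comp {f : V → X} (hf : Sm f) {g : W → V} (hg : ContDiff ℝ ∞ g) : Sm (f ∘ g) :=
  fun m h hh => hf m (g ∘ h) (hg.comp hh)

theorem SmAt.congr {f g : V → X} {x : V} (hf : SmAt f x) (h : f =ᶠ[𝓝 x] g) : SmAt g x :=
  let ⟨f', h1, h2⟩ := hf; ⟨f', h1, h2.trans h⟩

theorem SmAt.comp {f : V → X} {g : W → V} {x : W} (hf : SmAt f (g x)) (hg : ContDiff ℝ ∞ g) :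
    SmAt (fun y => f (g y)) x :=
  let ⟨f', h1, h2⟩ := hf
  ⟨f' ∘ g, h1.comp hg, hg.continuous.continuousAt.eventually h2⟩

theorem smAt_const (a : X) (x : V) : SmAt (fun _ => a) x := (sm_const a).smAt x

/-- This is the locality axiom: near each point the map agrees with a plot. -/
theorem sm_of_smAt {f : V → X} (hf : ∀ x, SmAt f x) : Sm f := by
  intro m g hg
  refine DiffeologicalSpace.locality fun y => ?_
  obtain ⟨f', h1, h2⟩ := hf (g y)
  obtain ⟨u, hu, hou, hyu⟩ := eventually_nhds_iff.1 (hg.continuous.continuousAt.eventually h2)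
  refine ⟨u, hou, hyu, fun {k h} hh hs => ?_⟩
  have : (f ∘ g) ∘ h = f' ∘ (g ∘ h) := funext fun z => (hu _ (hh z)).symm
  rw [this]
  exact h1 k _ (hg.comp hs)

theorem SmAt.dSmooth_comp {f : V → X} {x : V} (hf : SmAt f x) {F : X → Y} (hF : DSmooth F) :
    SmAt (fun y => F (f y)) x :=
  let ⟨f', h1, h2⟩ := hf
  ⟨F ∘ f', fun m g hg => hF m _ (h1 m g hg), h2.fun_comp F⟩

theorem Sm.isOpen_preimage [FiniteDimensional ℝ V] {f : V → X} (hf : Sm f) {U : Set X}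
    (hU : IsOpen[dTopology] U) : IsOpen (f ⁻¹' U) := by
  have h := isOpen_iff_preimages_plots.1 hU _ _ (hf _ _ (toEuclidean (E := V)).symm.contDiff)
  have h2 := h.preimage (toEuclidean (E := V)).continuous
  convert h2 using 1
  ext x
  simp

theorem SmAt.eventually_mem [FiniteDimensional ℝ V] {f : V → X} {x : V} (hf : SmAt f x)
    {U : Set X} (hU : IsOpen[dTopology] U) (hx : f x ∈ U) : ∀ᶠ y in 𝓝 x, f y ∈ U := by
  obtain ⟨f', h1, h2⟩ := hf
  have h3 : f' ⁻¹' U ∈ 𝓝 x := (h1.isOpen_preimage hU).mem_nhds (by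
    rw [Set.mem_preimage, h2.self_of_nhds]; exact hx)
  filter_upwards [h2, h3] with y hy hy'
  rw [← hy]
  exact hy'

/-- Smooth self-maps with arbitrarily small range which are the identity near a point. -/
theorem exists_contDiff_eventuallyEq_id [FiniteDimensional ℝ V] {x : V} {u : Set V}
    (hu : u ∈ 𝓝 x) :
    ∃ ρ : V → V, ContDiff ℝ ∞ ρ ∧ ρ =ᶠ[𝓝 x] id ∧ ∀ y, ρ y ∈ u := by
  obtain ⟨ε, hε, hεu⟩ := Metric.mem_nhds_iff.1 hu
  -- Inside the outer radius `ε / 2` the displacement `b y • (y - x)` has norm below `ε / 2`;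
  -- outside it the bump vanishes and the value is `x`.
  let b : ContDiffBump x := ⟨ε / 3, ε / 2, by positivity, by linarith⟩
  refine ⟨fun y => x + b y • (y - x), ?_, ?_, fun y => hεu ?_⟩
  · exact contDiff_const.add (b.contDiff.smul (contDiff_id.sub contDiff_const))
  · filter_upwards [b.eventuallyEq_one] with y hy
    simp [hy]
  · rw [Metric.mem_ball, dist_eq_norm, add_sub_cancel_left, norm_smul, Real.norm_eq_abs,
      abs_of_nonneg b.nonneg]
    by_cases hy : dist y x < ε / 2
    · rw [dist_eq_norm] at hy
      have := mul_le_mul b.le_one (le_refl ‖y - x‖) (norm_nonneg _) zero_le_one (a := b y)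
      linarith
    · rw [b.zero_of_le_dist (not_lt.1 hy)]
      simpa using hε

/-- Smoothness on `U` only concerns plots lying wholly in `U`, so the source is first squeezed into
the open preimage of `U`, without changing the germ. -/
theorem SmAt.comp_smoothOn [FiniteDimensional ℝ V] {f : V → X} {x : V} (hf : SmAt f x)
    {U : Set X} (hU : IsOpen[dTopology] U) (hx : f x ∈ U) {F : X → Y} (hF : SmoothOn F U) :
    SmAt (fun y => F (f y)) x := by
  obtain ⟨f', h1, h2⟩ := hf
  have h3 : f' ⁻¹' U ∈ 𝓝 x := (h1.isOpen_preimage hU).mem_nhds (by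
    rw [Set.mem_preimage, h2.self_of_nhds]; exact hx)
  obtain ⟨ρ, hρ, hρx, hρu⟩ := exists_contDiff_eventuallyEq_id h3
  refine ⟨fun y => F (f' (ρ y)), fun m g hg => ?_, ?_⟩
  · exact hF m (f' ∘ (ρ ∘ g)) (h1 _ _ (hρ.comp hg)) fun y => hρu _
  · filter_upwards [h2, hρx] with y hy hy'
    rw [hy', id, hy]

theorem smAt_mul {H : Type*} [Group H] [DiffeologicalSpace H] [DiffeologicalGroup H]
    {f g : V → H} {x : V} (hf : SmAt f x) (hg : SmAt g x) : SmAt (fun y => f y * g y) x :=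
  let ⟨f', h1, h2⟩ := hf
  let ⟨g', h3, h4⟩ := hg
  ⟨fun y => f' y * g' y, fun m k hk => DiffeologicalGroup.mul_plot (h1 m k hk) (h3 m k hk),
    h2.mul h4⟩

theorem smAt_inv {H : Type*} [Group H] [DiffeologicalSpace H] [DiffeologicalGroup H]
    {f : V → H} {x : V} (hf : SmAt f x) : SmAt (fun y => (f y)⁻¹) x :=
  let ⟨f', h1, h2⟩ := hf
  ⟨fun y => (f' y)⁻¹, fun m k hk => DiffeologicalGroup.inv_plot (h1 m k hk), h2.inv⟩

theorem sm_iff_contDiff [FiniteDimensional ℝ V] {f : V → ℝ} : Sm f ↔ ContDiff ℝ ∞ f := by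
  refine ⟨fun h => ?_, fun h m g hg => (h.comp hg).isPlot⟩
  have := (h _ _ (toEuclidean (E := V)).symm.contDiff).contDiff.comp
    (toEuclidean (E := V)).contDiff
  convert this using 1
  ext x
  simp

theorem SmAt.contDiffAt [FiniteDimensional ℝ V] {f : V → ℝ} {x : V} (h : SmAt f x) :
    ContDiffAt ℝ ∞ f x :=
  let ⟨_, h1, h2⟩ := h
  (sm_iff_contDiff.1 h1).contDiffAt.congr_of_eventuallyEq h2.symm

end Smooth

/-! ### Differential calculus with values in a convenient vector space. -/

section Convenient

variable {V W E : Type*} [NormedAddCommGroup V] [NormedSpace ℝ V] [FiniteDimensional ℝ V]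
  [NormedAddCommGroup W] [NormedSpace ℝ W] [FiniteDimensional ℝ W]
  [AddCommGroup E] [Module ℝ E] [DiffeologicalSpace E] [ConvenientSpace E]

/-- Separation reduces identities between derivatives in `E` to identities of real calculus. -/
theorem eq_of_functionals {v w : E} (h : ∀ ℓ : E →ₗ[ℝ] ℝ, DSmooth ℓ → ℓ v = ℓ w) : v = w := by
  by_contra hne
  obtain ⟨ℓ, h1, h2⟩ := ConvenientSpace.separated (v - w) (sub_ne_zero.2 hne)
  exact h2 (by rw [map_sub, h ℓ h1, sub_self])

theorem sm_of_functionals {f : V → E}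
    (h : ∀ ℓ : E →ₗ[ℝ] ℝ, DSmooth ℓ → ContDiff ℝ ∞ fun x => ℓ (f x)) : Sm f :=
  fun _ _ hg => ConvenientSpace.plot_of_scalarwise _ fun ℓ hℓ => (h ℓ hℓ).comp hg

theorem Sm.contDiff {f : V → E} (hf : Sm f) {ℓ : E →ₗ[ℝ] ℝ} (hℓ : DSmooth ℓ) :
    ContDiff ℝ ∞ fun x => ℓ (f x) :=
  sm_iff_contDiff.1 fun m g hg => hℓ m _ (hf m g hg)

theorem SmAt.differentiableAt {f : V → E} {x : V} (hf : SmAt f x) {ℓ : E →ₗ[ℝ] ℝ}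
    (hℓ : DSmooth ℓ) : DifferentiableAt ℝ (fun x => ℓ (f x)) x :=
  (hf.dSmooth_comp hℓ).contDiffAt.differentiableAt (by simp)

theorem smAt_add {f g : V → E} {x : V} (hf : SmAt f x) (hg : SmAt g x) :
    SmAt (fun y => f y + g y) x :=
  let ⟨f', h1, h2⟩ := hf
  let ⟨g', h3, h4⟩ := hg
  ⟨fun y => f' y + g' y, sm_of_functionals fun ℓ hℓ => by
    simpa using (h1.contDiff hℓ).add (h3.contDiff hℓ), h2.add h4⟩

theorem smAt_smul {f : V → ℝ} {g : V → E} {x : V} (hf : SmAt f x) (hg : SmAt g x) :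
    SmAt (fun y => f y • g y) x :=
  let ⟨f', h1, h2⟩ := hf
  let ⟨g', h3, h4⟩ := hg
  ⟨fun y => f' y • g' y, sm_of_functionals fun ℓ hℓ => by
    simpa using (sm_iff_contDiff.1 h1).mul (h3.contDiff hℓ), h2.smul h4⟩

theorem smAt_sum {ι : Type*} (s : Finset ι) {f : ι → V → E} {x : V}
    (hf : ∀ i ∈ s, SmAt (f i) x) : SmAt (fun y => ∑ i ∈ s, f i y) x := by
  classical
  induction s using Finset.induction_on with
  | empty => simpa using smAt_const (0 : E) x
  | insert a s ha ih =>
    simp only [Finset.sum_insert ha]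
    exact smAt_add (hf a (Finset.mem_insert_self a s))
      (ih fun i hi => hf i (Finset.mem_insert_of_mem hi))

/-- The derivative at `x` in the direction `v` of a map with values in a convenient space. -/
noncomputable def dirDeriv {V E : Type*} [NormedAddCommGroup V] [NormedSpace ℝ V]
    [AddCommGroup E] [Module ℝ E] [DiffeologicalSpace E] (f : V → E) (x v : V) : E :=
  curveDeriv fun t => f (x + t • v)

open Classical in
-- The derivative is a choice from a predicate on `E`. Curves with the same germ define the same
-- predicate, hence the same choice, also when no derivative exists.
theorem curveDeriv_congr {c c' : ℝ → E} (h : c =ᶠ[𝓝 0] c') : curveDeriv c = curveDeriv c' := by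
  have h' (v : E) (ℓ : E →ₗ[ℝ] ℝ) : HasDerivAt (fun t => ℓ (c t)) (ℓ v) 0 ↔
      HasDerivAt (fun t => ℓ (c' t)) (ℓ v) 0 :=
    Filter.EventuallyEq.hasDerivAt_iff (h.fun_comp ℓ)
  have gen (p q : E → Prop) (hpq : p = q) : (if h : ∃ v, p v then h.choose else 0) =
      if h : ∃ v, q v then h.choose else 0 := by rw [hpq]
  exact gen _ _ (funext fun v => propext (forall_congr' fun ℓ => forall_congr' fun _ => h' v ℓ))

theorem curveDeriv_eq_dirDeriv (c : ℝ → E) : curveDeriv c = dirDeriv c 0 1 := by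
  simp [dirDeriv]

theorem dirDeriv_congr {f g : V → E} {x : V} (h : f =ᶠ[𝓝 x] g) (v : V) :
    dirDeriv f x v = dirDeriv g x v := by
  refine curveDeriv_congr ?_
  have : ContinuousAt (fun t : ℝ => x + t • v) 0 := by fun_prop
  exact this.eventually (p := fun y => f y = g y) (by simp only [zero_smul, add_zero]; exact h)

theorem dirDeriv_eq_of_forall {f : V → E} {x v : V} {ξ : E}
    (h : ∀ ℓ : E →ₗ[ℝ] ℝ, DSmooth ℓ → HasDerivAt (fun t : ℝ => ℓ (f (x + t • v))) (ℓ ξ) 0) :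
    dirDeriv f x v = ξ := by
  have hex : ∃ v' : E, ∀ ℓ : E →ₗ[ℝ] ℝ, DSmooth ℓ →
      HasDerivAt (fun t : ℝ => ℓ (f (x + t • v))) (ℓ v') 0 := ⟨ξ, h⟩
  rw [dirDeriv, curveDeriv, dif_pos hex]
  exact eq_of_functionals fun ℓ hℓ => (hex.choose_spec ℓ hℓ).unique (h ℓ hℓ)

/-- Existence of derivatives of scalarwise smooth curves lets functionals pass through the
derivative; the remaining rules of calculus are read off from real ones through this. -/
theorem SmAt.apply_dirDeriv {f : V → E} {x : V} (hf : SmAt f x) (v : V) {ℓ : E →ₗ[ℝ] ℝ}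
    (hℓ : DSmooth ℓ) : ℓ (dirDeriv f x v) = fderiv ℝ (fun y => ℓ (f y)) x v := by
  obtain ⟨f', h1, h2⟩ := hf
  have h4 : (fun y => ℓ (f' y)) =ᶠ[𝓝 x] fun y => ℓ (f y) := h2.fun_comp ℓ
  rw [← dirDeriv_congr h2, ← h4.fderiv_eq]
  have hline : ContDiff ℝ ∞ fun t : ℝ => x + t • v := by fun_prop
  obtain ⟨ξ, hξ⟩ := ConvenientSpace.exists_deriv (fun t : ℝ => f' (x + t • v))
    fun ℓ hℓ => (h1.contDiff hℓ).comp hline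
  rw [dirDeriv_eq_of_forall hξ]
  have h3 := (((h1.contDiff hℓ).differentiable (by simp) (x + (0 : ℝ) • v)).hasFDerivAt.comp_hasDerivAt
    (0 : ℝ) (((hasDerivAt_id (0 : ℝ)).smul_const v).const_add x))
  have := (hξ ℓ hℓ).unique h3
  simpa using this

theorem dirDeriv_add_right {f : V → E} {x : V} (hf : SmAt f x) (v w : V) :
    dirDeriv f x (v + w) = dirDeriv f x v + dirDeriv f x w :=
  eq_of_functionals fun ℓ hℓ => by simp [hf.apply_dirDeriv _ hℓ]

theorem dirDeriv_smul_right {f : V → E} {x : V} (hf : SmAt f x) (a : ℝ) (v : V) :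
    dirDeriv f x (a • v) = a • dirDeriv f x v :=
  eq_of_functionals fun ℓ hℓ => by simp [hf.apply_dirDeriv _ hℓ]

theorem dirDeriv_const (a : E) (x v : V) : dirDeriv (fun _ => a) x v = 0 :=
  eq_of_functionals fun ℓ hℓ => by simp [(smAt_const a x).apply_dirDeriv _ hℓ]

theorem dirDeriv_add {f g : V → E} {x : V} (hf : SmAt f x) (hg : SmAt g x) (v : V) :
    dirDeriv (fun y => f y + g y) x v = dirDeriv f x v + dirDeriv g x v :=
  eq_of_functionals fun ℓ hℓ => by
    simp [(smAt_add hf hg).apply_dirDeriv _ hℓ, hf.apply_dirDeriv _ hℓ, hg.apply_dirDeriv _ hℓ,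
      fderiv_fun_add (hf.differentiableAt hℓ) (hg.differentiableAt hℓ)]

theorem SmAt.map {f : V → E} {x : V} (hf : SmAt f x) {L : E →ₗ[ℝ] E} (hL : DSmooth L) :
    SmAt (fun y => L (f y)) x := hf.dSmooth_comp hL

theorem dirDeriv_map {f : V → E} {x : V} (hf : SmAt f x) {L : E →ₗ[ℝ] E} (hL : DSmooth L) (v : V) :
    dirDeriv (fun y => L (f y)) x v = L (dirDeriv f x v) :=
  eq_of_functionals fun ℓ hℓ => by
    rw [(hf.map hL).apply_dirDeriv _ hℓ]
    exact (hf.apply_dirDeriv v (ℓ := ℓ ∘ₗ L) (hℓ.comp hL)).symm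

theorem dSmooth_smul (a : ℝ) : DSmooth (LinearMap.lsmul ℝ E a) := fun _ _ hp =>
  sm_iff_isPlot.1 (sm_of_smAt fun x => smAt_smul (smAt_const a x) ((sm_iff_isPlot.2 hp).smAt x))

theorem dirDeriv_const_smul {f : V → E} {x : V} (hf : SmAt f x) (a : ℝ) (v : V) :
    dirDeriv (fun y => a • f y) x v = a • dirDeriv f x v :=
  dirDeriv_map hf (dSmooth_smul a) v

theorem smAt_neg {f : V → E} {x : V} (hf : SmAt f x) : SmAt (fun y => -f y) x := by
  simpa using smAt_smul (smAt_const (-1 : ℝ) x) hf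

theorem smAt_sub {f g : V → E} {x : V} (hf : SmAt f x) (hg : SmAt g x) :
    SmAt (fun y => f y - g y) x := by
  simpa [sub_eq_add_neg] using smAt_add hf (smAt_neg hg)

theorem dirDeriv_neg {f : V → E} {x : V} (hf : SmAt f x) (v : V) :
    dirDeriv (fun y => -f y) x v = -dirDeriv f x v := by
  simpa using dirDeriv_const_smul hf (-1) v

theorem dirDeriv_sub {f g : V → E} {x : V} (hf : SmAt f x) (hg : SmAt g x) (v : V) :
    dirDeriv (fun y => f y - g y) x v = dirDeriv f x v - dirDeriv g x v := by
  simp only [sub_eq_add_neg]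
  rw [dirDeriv_add hf (smAt_neg hg), dirDeriv_neg hg]

theorem dirDeriv_comp {f : V → E} {g : W → V} {x : W} (hf : SmAt f (g x)) (hg : ContDiff ℝ ∞ g)
    (v : W) : dirDeriv (fun y => f (g y)) x v = dirDeriv f (g x) (fderiv ℝ g x v) :=
  eq_of_functionals fun ℓ hℓ => by
    rw [(hf.comp hg).apply_dirDeriv _ hℓ, hf.apply_dirDeriv _ hℓ]
    have h := (hf.differentiableAt hℓ).hasFDerivAt.comp x
      ((hg.differentiable (by simp)) x).hasFDerivAt
    have h2 : (fun y => ℓ (f (g y))) = (fun y => ℓ (f y)) ∘ g := rfl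
    rw [h2, h.fderiv]
    rfl

theorem smAt_dirDeriv {f : V → E} {x : V} (hf : SmAt f x) {g h : W → V} (hg : ContDiff ℝ ∞ g)
    (hh : ContDiff ℝ ∞ h) {y : W} (hy : g y = x) : SmAt (fun z => dirDeriv f (g z) (h z)) y := by
  obtain ⟨f', h1, h2⟩ := hf
  refine ⟨fun z => dirDeriv f' (g z) (h z), ?_, ?_⟩
  · refine sm_of_functionals fun ℓ hℓ => ?_
    simp only [(h1.smAt _).apply_dirDeriv _ hℓ]
    exact (((h1.contDiff hℓ).fderiv_right (m := ∞) (by simp)).comp hg).clm_apply hh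
  · have : ∀ᶠ z in 𝓝 y, f' =ᶠ[𝓝 (g z)] f :=
      hg.continuous.continuousAt.eventually (by rw [hy]; exact h2.eventually_nhds)
    exact this.mono fun z hz => dirDeriv_congr hz _

/-- After applying a functional this is the symmetry of the second derivative of a smooth real
function. -/
theorem dirDeriv_dirDeriv_comm {f : V → E} {x : V} (hf : SmAt f x) (v w : V) :
    dirDeriv (fun y => dirDeriv f y w) x v = dirDeriv (fun y => dirDeriv f y v) x w := by
  obtain ⟨f', h1, h2⟩ := hf
  have hc (w : V) : (fun y => dirDeriv f' y w) =ᶠ[𝓝 x] fun y => dirDeriv f y w :=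
    h2.eventually_nhds.mono fun y hy => dirDeriv_congr hy _
  rw [← dirDeriv_congr (hc w), ← dirDeriv_congr (hc v)]
  have hs (w : V) : SmAt (fun y => dirDeriv f' y w) x :=
    smAt_dirDeriv (h1.smAt x) (g := id) contDiff_id contDiff_const rfl
  refine eq_of_functionals fun ℓ hℓ => ?_
  rw [(hs w).apply_dirDeriv _ hℓ, (hs v).apply_dirDeriv _ hℓ]
  simp only [(h1.smAt _).apply_dirDeriv _ hℓ]
  have hC := h1.contDiff hℓ
  have hd : DifferentiableAt ℝ (fderiv ℝ fun y => ℓ (f' y)) x :=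
    (hC.fderiv_right (m := ∞) (by simp)).differentiable (by simp) x
  rw [fderiv_clm_apply hd (by fun_prop), fderiv_clm_apply hd (by fun_prop)]
  have := (hC.contDiffAt (x := x)).isSymmSndFDerivAt (by
    rw [minSmoothness_of_isRCLikeNormedField]; exact WithTop.coe_le_coe.2 (le_top (a := (2 : ℕ∞))))
  simpa using this v w

/-- The Leibniz rule: the derivative along the diagonal is the sum of the partial derivatives. -/
theorem dirDeriv_diag {f : V → V → E} {x : V} (hf : SmAt (fun z : V × V => f z.1 z.2) (x, x))
    (v : V) : dirDeriv (fun y => f y y) x v =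
      dirDeriv (fun y => f y x) x v + dirDeriv (fun y => f x y) x v := by
  have h0 := dirDeriv_comp (g := fun y : V => (y, y)) hf (by fun_prop) v
  have h1 := dirDeriv_comp (g := fun y : V => (y, x)) hf (by fun_prop) v
  have h2 := dirDeriv_comp (g := fun y : V => (x, y)) hf (by fun_prop) v
  rw [h0, h1, h2, ← dirDeriv_add_right hf]
  congr 1
  rw [(hasFDerivAt_prodMk_left x x).fderiv, (hasFDerivAt_prodMk_right x x).fderiv,
    HasFDerivAt.fderiv (f := fun y : V => (y, y)) ((hasFDerivAt_id x).prodMk (hasFDerivAt_id x))]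
  simp

/-- Hadamard's lemma for curves in a convenient space. -/
theorem SmAt.exists_eq_add_smul {c : ℝ → E} (hc : SmAt c 0) :
    ∃ e : ℝ → E, Sm e ∧ (∀ᶠ t in 𝓝 0, c t = c 0 + t • e t) ∧ e 0 = curveDeriv c := by
  obtain ⟨c', h1, h2⟩ := hc
  rw [← curveDeriv_congr h2, curveDeriv_eq_dirDeriv]
  -- Smoothness is scalarwise: for each functional, `ℓ ∘ e` coincides with the Hadamard quotient of
  -- `ℓ ∘ c'`, including at `t = 0`.
  let e : ℝ → E := fun t => if t = 0 then dirDeriv c' 0 1 else t⁻¹ • (c' t - c' 0)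
  refine ⟨e, sm_of_functionals fun ℓ hℓ => ?_, ?_, by simp [e]⟩
  · obtain ⟨k, hk, hk1, hk2⟩ := exists_contDiff_eq_add_smul (h1.contDiff hℓ)
    convert hk using 1
    funext t
    by_cases ht : t = 0
    · simp [e, ht, hk2, (h1.smAt 0).apply_dirDeriv _ hℓ]
    · simp [e, ht, hk1 t]
  · filter_upwards [h2] with t ht
    rw [← ht, ← h2.self_of_nhds]
    by_cases h : t = 0
    · simp [h]
    · simp [e, h]

end Convenient

/-! ### Partial derivatives in two independent variables. -/

section Partial

variable {V W E : Type*} [NormedAddCommGroup V] [NormedSpace ℝ V] [FiniteDimensional ℝ V]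
  [NormedAddCommGroup W] [NormedSpace ℝ W] [FiniteDimensional ℝ W]
  [AddCommGroup E] [Module ℝ E] [DiffeologicalSpace E] [ConvenientSpace E]

theorem dirDeriv_snd (F : V → W → E) (x : V) (y w : W) :
    dirDeriv (F x) y w = dirDeriv (fun z : V × W => F z.1 z.2) (x, y) (0, w) := by
  simp [dirDeriv]

theorem dirDeriv_fst (F : V → W → E) (x v : V) (y : W) :
    dirDeriv (fun x => F x y) x v = dirDeriv (fun z : V × W => F z.1 z.2) (x, y) (v, 0) := by
  simp [dirDeriv]

theorem smAt_dirDeriv_snd {F : V → W → E} {x : V} {y : W}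
    (hF : SmAt (fun z : V × W => F z.1 z.2) (x, y)) (w : W) :
    SmAt (fun z : V × W => dirDeriv (F z.1) z.2 w) (x, y) := by
  simp only [dirDeriv_snd F]
  exact smAt_dirDeriv hF (g := fun z : V × W => (z.1, z.2)) (h := fun _ : V × W => ((0 : V), w)) (by fun_prop)
    (by fun_prop) rfl

theorem smAt_dirDeriv_fst {F : V → W → E} {x : V} {y : W}
    (hF : SmAt (fun z : V × W => F z.1 z.2) (x, y)) (v : V) :
    SmAt (fun z : V × W => dirDeriv (fun x => F x z.2) z.1 v) (x, y) := by
  simp only [dirDeriv_fst F]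
  exact smAt_dirDeriv hF (g := fun z : V × W => (z.1, z.2)) (h := fun _ : V × W => (v, (0 : W))) (by fun_prop)
    (by fun_prop) rfl

theorem dirDeriv_partial_comm {F : V → W → E} {x : V} {y : W}
    (hF : SmAt (fun z : V × W => F z.1 z.2) (x, y)) (v : V) (w : W) :
    dirDeriv (fun x => dirDeriv (F x) y w) x v =
      dirDeriv (fun y => dirDeriv (fun x => F x y) x v) y w := by
  have h := dirDeriv_dirDeriv_comm hF (v, 0) (0, w)
  have h1 := dirDeriv_fst (fun (x : V) (y : W) => dirDeriv (F x) y w) x v y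
  have h2 := dirDeriv_snd (fun (x : V) (y : W) => dirDeriv (fun x => F x y) x v) x y w
  rw [h1, h2]
  simp only [dirDeriv_snd F, dirDeriv_fst F]
  exact h

end Partial

/-! ### Lie theory in a chart at the identity: adjoint action, bracket, Maurer–Cartan equation,
gauge transformations. -/

section Lie

variable {H E : Type*} [Group H] [DiffeologicalSpace H] [DiffeologicalGroup H]
  [AddCommGroup E] [Module ℝ E] [DiffeologicalSpace E] [ConvenientSpace E]

namespace LieChart

variable (φ : LieChart H E) {V : Type*} [NormedAddCommGroup V] [NormedSpace ℝ V]
  [FiniteDimensional ℝ V]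

theorem smAt_chart {a : V → H} {x : V} (ha : SmAt a x) (hx : a x ∈ φ.source) :
    SmAt (fun y => φ.toFun (a y)) x :=
  ha.comp_smoothOn φ.open_source hx φ.smooth_toFun

theorem smAt_invFun {ξ : V → E} {x : V} (hξ : SmAt ξ x) (hx : ξ x = 0) :
    SmAt (fun y => φ.invFun (φ.toFun 1 + ξ y)) x := by
  refine (smAt_add (smAt_const (φ.toFun 1) x) hξ).comp_smoothOn φ.open_target ?_ φ.smooth_invFun
  rw [hx, add_zero]
  exact φ.map_source φ.one_mem

theorem eventually_chart_invFun {ξ : V → E} {x : V} (hξ : SmAt ξ x) (hx : ξ x = 0) :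
    ∀ᶠ y in 𝓝 x, φ.toFun (φ.invFun (φ.toFun 1 + ξ y)) = φ.toFun 1 + ξ y := by
  have h := (smAt_add (smAt_const (φ.toFun 1) x) hξ).eventually_mem φ.open_target
    (by rw [hx, add_zero]; exact φ.map_source φ.one_mem)
  exact h.mono fun y hy => φ.right_inv hy

theorem invFun_chart_one : φ.invFun (φ.toFun 1) = 1 := φ.left_inv φ.one_mem

theorem curve_zero (ξ : E) : φ.curve ξ 0 = 1 := by
  simp [curve, invFun_chart_one]

theorem smAt_curve {ξ : V → E} {τ : V → ℝ} {x : V} (hξ : SmAt ξ x) (hτ : SmAt τ x)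
    (hx : τ x = 0) : SmAt (fun y => φ.curve (ξ y) (τ y)) x :=
  φ.smAt_invFun (smAt_smul hτ hξ) (by simp [hx])

/-- The differential at `1` of a map on `H`, in the chart. -/
noncomputable def diff (Ψ : H → E) (ξ : E) : E := curveDeriv fun t => Ψ (φ.curve ξ t)

/-- The chain rule at `1`. -/
theorem dirDeriv_eq_diff {Ψ : H → E} {S : Set H} (hS : IsOpen[dTopology] S) (h1 : (1 : H) ∈ S)
    (hΨ : SmoothOn Ψ S) {a : V → H} {x : V} (ha : SmAt a x) (hx : a x = 1) (v : V) :
    dirDeriv (fun y => Ψ (a y)) x v = φ.diff Ψ (dirDeriv (fun y => φ.toFun (a y)) x v) := by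
  have hb : SmAt (fun t : ℝ => a (x + t • v)) 0 :=
    SmAt.comp (g := fun t : ℝ => x + t • v) (by simpa using ha) (by fun_prop)
  have hb1 : a (x + (0 : ℝ) • v) = 1 := by simpa using hx
  have hbs : a (x + (0 : ℝ) • v) ∈ φ.source := by rw [hb1]; exact φ.one_mem
  -- Hadamard's lemma in the chart writes the curve as `curve (e t) t`, where `e 0` is its velocity.
  obtain ⟨e, he, hce, he0⟩ := (φ.smAt_chart hb hbs).exists_eq_add_smul
  have hbe : (fun t : ℝ => Ψ (a (x + t • v))) =ᶠ[𝓝 0] fun t => Ψ (φ.curve (e t) t) := by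
    filter_upwards [hce, hb.eventually_mem φ.open_source hbs] with t ht hts
    rw [curve]
    rw [hb1] at ht
    rw [← ht]
    exact congrArg Ψ (φ.left_inv hts).symm
  have hF : SmAt (fun z : ℝ × ℝ => Ψ (φ.curve (e z.2) z.1)) ((0 : ℝ), (0 : ℝ)) := by
    refine SmAt.comp_smoothOn (φ.smAt_curve ((he.comp contDiff_snd).smAt _)
      ((sm_iff_contDiff.2 contDiff_fst).smAt _) rfl) hS ?_ hΨ
    simpa only [curve_zero] using h1
  -- Differentiate the two occurrences of `t` separately. At `s = 0` the curve is constantly `1`, so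
  -- varying `e` contributes nothing and only the straight curve with velocity `e 0` remains.
  have hd := dirDeriv_diag (f := fun s t => Ψ (φ.curve (e t) s)) hF 1
  rw [show dirDeriv (fun y => Ψ (a y)) x v = curveDeriv fun t : ℝ => Ψ (a (x + t • v)) from rfl,
    curveDeriv_congr hbe, curveDeriv_eq_dirDeriv, hd]
  simp only [curve_zero, dirDeriv_const, add_zero]
  rw [he0, diff, ← curveDeriv_eq_dirDeriv]
  rfl

theorem dirDeriv_chart_invFun {ξ : V → E} {x : V} (hξ : SmAt ξ x) (hx : ξ x = 0) (v : V) :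
    dirDeriv (fun y => φ.toFun (φ.invFun (φ.toFun 1 + ξ y))) x v = dirDeriv ξ x v := by
  rw [dirDeriv_congr (φ.eventually_chart_invFun hξ hx),
    dirDeriv_add (smAt_const _ x) hξ, dirDeriv_const, zero_add]

theorem smAt_linear_pair (ξ η : E) (x : ℝ × ℝ) : SmAt (fun z : ℝ × ℝ => z.1 • ξ + z.2 • η) x :=
  smAt_add (smAt_smul ((sm_iff_contDiff.2 contDiff_fst).smAt _) (smAt_const ξ _))
    (smAt_smul ((sm_iff_contDiff.2 contDiff_snd).smAt _) (smAt_const η _))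

theorem dirDeriv_linear_pair (ξ η : E) (x v : ℝ × ℝ) :
    dirDeriv (fun z : ℝ × ℝ => z.1 • ξ + z.2 • η) x v = v.1 • ξ + v.2 • η := by
  refine eq_of_functionals fun ℓ hℓ => ?_
  rw [(smAt_linear_pair ξ η x).apply_dirDeriv v hℓ]
  have : (fun z : ℝ × ℝ => ℓ (z.1 • ξ + z.2 • η)) = fun z => z.1 * ℓ ξ + z.2 * ℓ η := by
    funext z; simp
  rw [this]
  have h := ((hasFDerivAt_fst (𝕜 := ℝ) (p := x)).mul_const (ℓ ξ)).add
    ((hasFDerivAt_snd (𝕜 := ℝ) (p := x)).mul_const (ℓ η))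
  rw [HasFDerivAt.fderiv (f := fun z : ℝ × ℝ => z.1 * ℓ ξ + z.2 * ℓ η) h]
  simp [mul_comm]

/-- The two-parameter family in `H` with velocities `ξ` and `η` at the origin. -/
theorem exists_family (ξ η : E) : ∃ k : ℝ × ℝ → H, SmAt k 0 ∧ k 0 = 1 ∧
    ∀ v : ℝ × ℝ, dirDeriv (fun y => φ.toFun (k y)) 0 v = v.1 • ξ + v.2 • η := by
  refine ⟨fun z => φ.invFun (φ.toFun 1 + (z.1 • ξ + z.2 • η)),
    φ.smAt_invFun (smAt_linear_pair ξ η 0) (by simp), by simp [invFun_chart_one], fun v => ?_⟩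
  rw [φ.dirDeriv_chart_invFun (smAt_linear_pair ξ η 0) (by simp), dirDeriv_linear_pair]

section Diff

variable {Ψ : H → E} {S : Set H} (hS : IsOpen[dTopology] S) (h1 : (1 : H) ∈ S)
  (hΨ : SmoothOn Ψ S)

include hS h1 hΨ

/-- Linearity is transported from `ℝ × ℝ`: along a two-parameter family with velocities `ξ` and `η`,
the chain rule identifies the differential with a directional derivative, which is linear in its
direction. -/
theorem diff_combination (a b : ℝ) (ξ η : E) :
    φ.diff Ψ (a • ξ + b • η) = a • φ.diff Ψ ξ + b • φ.diff Ψ η := by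
  obtain ⟨k, hk, hk0, hkd⟩ := φ.exists_family ξ η
  have key (v : ℝ × ℝ) : dirDeriv (fun y => Ψ (k y)) 0 v = φ.diff Ψ (v.1 • ξ + v.2 • η) := by
    rw [φ.dirDeriv_eq_diff hS h1 hΨ hk hk0, hkd]
  have hΨk : SmAt (fun y => Ψ (k y)) 0 := hk.comp_smoothOn hS (by rwa [hk0]) hΨ
  have e1 := key (1, 0)
  have e2 := key (0, 1)
  have e3 := key (a, b)
  have : ((a, b) : ℝ × ℝ) = a • (1, 0) + b • (0, 1) := by simp
  rw [this, dirDeriv_add_right hΨk, dirDeriv_smul_right hΨk, dirDeriv_smul_right hΨk, e1, e2] at e3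
  simpa using e3.symm

theorem diff_add (ξ η : E) : φ.diff Ψ (ξ + η) = φ.diff Ψ ξ + φ.diff Ψ η := by
  simpa using φ.diff_combination hS h1 hΨ 1 1 ξ η

theorem diff_smul (a : ℝ) (ξ : E) : φ.diff Ψ (a • ξ) = a • φ.diff Ψ ξ := by
  simpa using φ.diff_combination hS h1 hΨ a 0 ξ 0

theorem diff_neg (ξ : E) : φ.diff Ψ (-ξ) = -φ.diff Ψ ξ := by
  simpa using φ.diff_smul hS h1 hΨ (-1) ξ

end Diff

theorem isOpen_translate (u w : H) : IsOpen[dTopology] {g : H | u * g * w ∈ φ.source} := by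
  rw [isOpen_iff_preimages_plots]
  intro n p hp
  exact isOpen_iff_preimages_plots.1 φ.open_source n _
    (DiffeologicalGroup.mul_plot (DiffeologicalGroup.mul_plot isPlot_const hp) isPlot_const)

theorem smoothOn_translate (u w : H) :
    SmoothOn (fun g => φ.toFun (u * g * w)) {g : H | u * g * w ∈ φ.source} := fun m _ hp hU =>
  φ.smooth_toFun m _
    (DiffeologicalGroup.mul_plot (DiffeologicalGroup.mul_plot isPlot_const hp) isPlot_const) hU

/-- `Ad h` is the differential at `1` of conjugation read in the chart, so any family through `1`
may replace the straight curve of its definition. -/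
theorem dirDeriv_conj {a : V → H} {x : V} (ha : SmAt a x) (hx : a x = 1) (h : H) (v : V) :
    dirDeriv (fun y => φ.toFun (h * a y * h⁻¹)) x v =
      φ.Ad h (dirDeriv (fun y => φ.toFun (a y)) x v) :=
  φ.dirDeriv_eq_diff (φ.isOpen_translate h h⁻¹) (by simp [φ.one_mem]) (φ.smoothOn_translate h h⁻¹)
    ha hx v

theorem dirDeriv_curve (ξ : E) : dirDeriv (fun t => φ.toFun (φ.curve ξ t)) 0 1 = ξ := by
  have h : SmAt (fun t : ℝ => t • ξ) 0 :=
    smAt_smul ((sm_iff_contDiff.2 contDiff_id).smAt _) (smAt_const ξ _)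
  have h2 := φ.dirDeriv_chart_invFun h (zero_smul ℝ ξ) 1
  refine h2.trans (eq_of_functionals fun ℓ hℓ => ?_)
  rw [h.apply_dirDeriv _ hℓ]
  have : (fun t : ℝ => ℓ (t • ξ)) = fun t => t * ℓ ξ := by funext z; simp
  rw [this, HasFDerivAt.fderiv (f := fun t : ℝ => t * ℓ ξ) ((hasFDerivAt_id (𝕜 := ℝ) (0 : ℝ)).mul_const (ℓ ξ))]
  simp

theorem smAt_curve_id (ξ : E) : SmAt (φ.curve ξ) 0 :=
  φ.smAt_curve (smAt_const ξ _) ((sm_iff_contDiff.2 contDiff_id).smAt _) rfl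

theorem Ad_mul (g h : H) (ξ : E) : φ.Ad (g * h) ξ = φ.Ad g (φ.Ad h ξ) := by
  have hc := smAt_mul (smAt_mul (smAt_const h 0) (φ.smAt_curve_id ξ)) (smAt_const h⁻¹ 0)
  have h1 := φ.dirDeriv_conj (φ.smAt_curve_id ξ) (φ.curve_zero ξ) (g * h) 1
  have h2 := φ.dirDeriv_conj hc (by simp [curve_zero]) g 1
  rw [φ.dirDeriv_conj (φ.smAt_curve_id ξ) (φ.curve_zero ξ) h 1, dirDeriv_curve] at h2
  rw [dirDeriv_curve] at h1
  rw [← h1, ← h2]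
  simp only [mul_inv_rev, mul_assoc]

theorem Ad_one (ξ : E) : φ.Ad 1 ξ = ξ := by
  have h1 := φ.dirDeriv_conj (φ.smAt_curve_id ξ) (φ.curve_zero ξ) 1 1
  rw [dirDeriv_curve] at h1
  rw [← h1]
  simpa using φ.dirDeriv_curve ξ

/-- The adjoint action is the time derivative at 0 of a family smooth jointly in the parameter and
in time. -/
theorem smAt_Ad {h : V → H} {ξ : V → E} {x : V} (hh : SmAt h x) (hξ : SmAt ξ x) :
    SmAt (fun y => φ.Ad (h y) (ξ y)) x := by
  have hF : SmAt (fun z : V × ℝ => φ.toFun (h z.1 * φ.curve (ξ z.1) z.2 * (h z.1)⁻¹)) (x, 0) := by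
    have h1 : SmAt (fun z : V × ℝ => h z.1) (x, (0 : ℝ)) := hh.comp (x := (x, (0 : ℝ))) contDiff_fst
    have h2 : SmAt (fun z : V × ℝ => ξ z.1) (x, (0 : ℝ)) := hξ.comp (x := (x, (0 : ℝ))) contDiff_fst
    refine φ.smAt_chart (smAt_mul (smAt_mul h1 (φ.smAt_curve h2
      ((sm_iff_contDiff.2 contDiff_snd).smAt _) rfl)) (smAt_inv h1)) ?_
    simpa [curve_zero] using φ.one_mem
  have h2 := smAt_dirDeriv hF (g := fun y : V => (y, 0)) (h := fun _ => (0, 1)) (by fun_prop)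
    (by fun_prop) rfl
  refine h2.congr (Filter.Eventually.of_forall fun y => ?_)
  simp [dirDeriv, Ad]

/-- The adjoint action by a fixed group element, as a linear map. -/
noncomputable def AdLinear (h : H) : E →ₗ[ℝ] E where
  toFun := φ.Ad h
  map_add' := φ.diff_add (φ.isOpen_translate h h⁻¹) (by simp [φ.one_mem])
    (φ.smoothOn_translate h h⁻¹)
  map_smul' := φ.diff_smul (φ.isOpen_translate h h⁻¹) (by simp [φ.one_mem])
    (φ.smoothOn_translate h h⁻¹)

theorem dSmooth_AdLinear (h : H) : DSmooth (φ.AdLinear h) := fun _ _ hp =>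
  sm_iff_isPlot.1 (sm_of_smAt fun x => φ.smAt_Ad (smAt_const h x) ((sm_iff_isPlot.2 hp).smAt x))

theorem Ad_add (h : H) (ξ η : E) : φ.Ad h (ξ + η) = φ.Ad h ξ + φ.Ad h η :=
  map_add (φ.AdLinear h) ξ η

theorem Ad_sub (h : H) (ξ η : E) : φ.Ad h (ξ - η) = φ.Ad h ξ - φ.Ad h η :=
  map_sub (φ.AdLinear h) ξ η

theorem Ad_smul (h : H) (a : ℝ) (ξ : E) : φ.Ad h (a • ξ) = a • φ.Ad h ξ :=
  map_smul (φ.AdLinear h) a ξ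

theorem smoothOn_Ad (η : E) : SmoothOn (fun g => φ.Ad g η) Set.univ := fun _ _ hp _ =>
  sm_iff_isPlot.1 (sm_of_smAt fun x => φ.smAt_Ad ((sm_iff_isPlot.2 hp).smAt x) (smAt_const η x))

theorem isOpen_univ_dTopology : IsOpen[dTopology] (Set.univ : Set H) :=
  @isOpen_univ H dTopology

theorem dirDeriv_Ad_const {a : V → H} {x : V} (ha : SmAt a x) (hx : a x = 1) (η : E) (v : V) :
    dirDeriv (fun y => φ.Ad (a y) η) x v =
      φ.bracket (dirDeriv (fun y => φ.toFun (a y)) x v) η :=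
  φ.dirDeriv_eq_diff isOpen_univ_dTopology trivial (φ.smoothOn_Ad η) ha hx v

theorem bracket_add_left (ξ ξ' η : E) :
    φ.bracket (ξ + ξ') η = φ.bracket ξ η + φ.bracket ξ' η :=
  φ.diff_add isOpen_univ_dTopology trivial (φ.smoothOn_Ad η) ξ ξ'

theorem bracket_smul_left (a : ℝ) (ξ η : E) : φ.bracket (a • ξ) η = a • φ.bracket ξ η :=
  φ.diff_smul isOpen_univ_dTopology trivial (φ.smoothOn_Ad η) a ξ

theorem bracket_neg_left (ξ η : E) : φ.bracket (-ξ) η = -φ.bracket ξ η :=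
  φ.diff_neg isOpen_univ_dTopology trivial (φ.smoothOn_Ad η) ξ

/-- By the Leibniz rule along the diagonal: each partial derivative has the other factor frozen at
`1`. -/
theorem dirDeriv_chart_mul {a b : V → H} {x : V} (ha : SmAt a x) (hb : SmAt b x) (hax : a x = 1)
    (hbx : b x = 1) (v : V) : dirDeriv (fun y => φ.toFun (a y * b y)) x v =
      dirDeriv (fun y => φ.toFun (a y)) x v + dirDeriv (fun y => φ.toFun (b y)) x v := by
  have hF : SmAt (fun z : V × V => φ.toFun (a z.1 * b z.2)) (x, x) :=
    φ.smAt_chart (smAt_mul (ha.comp (x := (x, x)) contDiff_fst) (hb.comp (x := (x, x)) contDiff_snd))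
      (by simpa [hax, hbx] using φ.one_mem)
  rw [dirDeriv_diag (f := fun y z => φ.toFun (a y * b z)) hF]
  simp [hax, hbx]

theorem dirDeriv_chart_inv {a : V → H} {x : V} (ha : SmAt a x) (hax : a x = 1) (v : V) :
    dirDeriv (fun y => φ.toFun (a y)⁻¹) x v = -dirDeriv (fun y => φ.toFun (a y)) x v := by
  have h := φ.dirDeriv_chart_mul ha (smAt_inv ha) hax (by simp [hax]) v
  simp only [mul_inv_cancel, dirDeriv_const] at h
  exact (neg_eq_of_add_eq_zero_right h.symm).symm

/-- The translated chart `g ↦ φ(ug)` is smooth near `1`, so its differential there is linear and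
sees the reversed velocity of `a⁻¹`. Allowing `u ≠ 1` is what permits a further derivative in `u`.
-/
theorem dirDeriv_mul_inv_right {a : V → H} {x : V} (ha : SmAt a x) (hax : a x = 1) {u : H}
    (hu : u ∈ φ.source) (v : V) : dirDeriv (fun y => φ.toFun (u * (a y)⁻¹)) x v =
      -dirDeriv (fun y => φ.toFun (u * a y)) x v := by
  have hS := φ.isOpen_translate u 1
  have h1 : (1 : H) ∈ {g : H | u * g * 1 ∈ φ.source} := by simpa using hu
  have e1 := φ.dirDeriv_eq_diff hS h1 (φ.smoothOn_translate u 1) ha hax v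
  have e2 := φ.dirDeriv_eq_diff hS h1 (φ.smoothOn_translate u 1) (smAt_inv ha) (by simp [hax]) v
  rw [φ.dirDeriv_chart_inv ha hax, φ.diff_neg hS h1 (φ.smoothOn_translate u 1), ← e1] at e2
  simpa using e2

theorem dirDeriv_inv_mul_left {a : V → H} {x : V} (ha : SmAt a x) (hax : a x = 1) {u : H}
    (hu : u ∈ φ.source) (v : V) : dirDeriv (fun y => φ.toFun ((a y)⁻¹ * u)) x v =
      -dirDeriv (fun y => φ.toFun (a y * u)) x v := by
  have hS := φ.isOpen_translate 1 u
  have h1 : (1 : H) ∈ {g : H | 1 * g * u ∈ φ.source} := by simpa using hu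
  have e1 := φ.dirDeriv_eq_diff hS h1 (φ.smoothOn_translate 1 u) ha hax v
  have e2 := φ.dirDeriv_eq_diff hS h1 (φ.smoothOn_translate 1 u) (smAt_inv ha) (by simp [hax]) v
  rw [φ.dirDeriv_chart_inv ha hax, φ.diff_neg hS h1 (φ.smoothOn_translate 1 u), ← e1] at e2
  simpa using e2

section Bracket

variable {k : V → H} {x : V} (hk : SmAt k x) (hkx : k x = 1)

include hk hkx

/-- The bracket is the `v`-derivative in `y` of the `w`-velocity of `z ↦ k(y) k(z) k(y)⁻¹`. Varying
the left `y` alone gives the first mixed derivative. Varying the right one alone gives that of `k(z)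
k(y)⁻¹`; exchanging partials and removing the inverse at the cost of a sign turns it into the
second. -/
theorem bracket_dirDeriv (v w : V) :
    φ.bracket (dirDeriv (fun y => φ.toFun (k y)) x v) (dirDeriv (fun y => φ.toFun (k y)) x w) =
      dirDeriv (fun y => dirDeriv (fun z => φ.toFun (k y * k z)) x w) x v -
        dirDeriv (fun y => dirDeriv (fun z => φ.toFun (k y * k z)) x v) x w := by
  rw [← φ.dirDeriv_Ad_const hk hkx]
  simp only [← φ.dirDeriv_conj hk hkx]
  have hG : SmAt (fun z : (V × V) × V => φ.toFun (k z.1.1 * k z.2 * (k z.1.2)⁻¹)) ((x, x), x) := by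
    refine φ.smAt_chart (smAt_mul (smAt_mul (hk.comp (x := ((x, x), x)) (g := fun z => z.1.1) ?_)
      (hk.comp (x := ((x, x), x)) (g := fun z => z.2) ?_))
      (smAt_inv (hk.comp (x := ((x, x), x)) (g := fun z => z.1.2) ?_))) ?_
    iterate 3 fun_prop
    simpa [hkx] using φ.one_mem
  have hG2 := (smAt_dirDeriv_snd (F := fun (p : V × V) z => φ.toFun (k p.1 * k z * (k p.2)⁻¹))
    hG w).comp (x := (x, x)) (g := fun p : V × V => (p, x)) (by fun_prop)
  rw [dirDeriv_diag (f := fun y y' => dirDeriv (fun z => φ.toFun (k y * k z * (k y')⁻¹)) x w) hG2]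
  simp only [hkx, inv_one, mul_one, one_mul]
  rw [sub_eq_add_neg]
  congr 1
  have hs : SmAt (fun z : V × V => φ.toFun (k z.2 * (k z.1)⁻¹)) (x, x) :=
    φ.smAt_chart (smAt_mul (hk.comp (x := (x, x)) contDiff_snd)
      (smAt_inv (hk.comp (x := (x, x)) contDiff_fst))) (by simpa [hkx] using φ.one_mem)
  have hs2 : SmAt (fun z : V × V => φ.toFun (k z.1 * k z.2)) (x, x) :=
    φ.smAt_chart (smAt_mul (hk.comp (x := (x, x)) contDiff_fst)
      (hk.comp (x := (x, x)) contDiff_snd)) (by simpa [hkx] using φ.one_mem)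
  rw [dirDeriv_partial_comm (F := fun y z => φ.toFun (k z * (k y)⁻¹)) hs]
  have hev : (fun z => dirDeriv (fun y => φ.toFun (k z * (k y)⁻¹)) x v) =ᶠ[𝓝 x]
      fun z => -dirDeriv (fun y => φ.toFun (k z * k y)) x v := by
    filter_upwards [hk.eventually_mem φ.open_source (by rw [hkx]; exact φ.one_mem)] with z hz
    exact φ.dirDeriv_mul_inv_right hk hkx hz v
  rw [dirDeriv_congr hev, dirDeriv_neg]
  exact (smAt_dirDeriv_snd (F := fun y z => φ.toFun (k y * k z)) hs2 v).comp
    (g := fun z : V => (z, x)) (by fun_prop)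

end Bracket

/-- The mixed-derivative formula is visibly antisymmetric, and a two-parameter family realises any
pair of velocities. -/
theorem bracket_antisymm (ξ η : E) : φ.bracket ξ η = -φ.bracket η ξ := by
  obtain ⟨k, hk, hk0, hkd⟩ := φ.exists_family ξ η
  have h1 := φ.bracket_dirDeriv hk hk0 (1, 0) (0, 1)
  have h2 := φ.bracket_dirDeriv hk hk0 (0, 1) (1, 0)
  simp only [hkd, one_smul, zero_smul, add_zero, zero_add] at h1 h2
  rw [h1, h2, neg_sub]

theorem bracket_add_right (ξ η η' : E) :
    φ.bracket ξ (η + η') = φ.bracket ξ η + φ.bracket ξ η' := by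
  rw [bracket_antisymm, bracket_add_left, φ.bracket_antisymm η, φ.bracket_antisymm η']
  abel

theorem bracket_smul_right (a : ℝ) (ξ η : E) : φ.bracket ξ (a • η) = a • φ.bracket ξ η := by
  rw [bracket_antisymm, bracket_smul_left, φ.bracket_antisymm η, smul_neg, neg_neg]

theorem bracket_zero_left (η : E) : φ.bracket 0 η = 0 := by
  simpa using φ.bracket_smul_left 0 0 η

theorem bracket_zero_right (ξ : E) : φ.bracket ξ 0 = 0 := by
  simpa using φ.bracket_smul_right 0 ξ 0

theorem smAt_bracket {ξ η : V → E} {x : V} (hξ : SmAt ξ x) (hη : SmAt η x) :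
    SmAt (fun y => φ.bracket (ξ y) (η y)) x := by
  have hF : SmAt (fun z : V × ℝ => φ.Ad (φ.curve (ξ z.1) z.2) (η z.1)) (x, 0) :=
    φ.smAt_Ad (φ.smAt_curve (hξ.comp (x := (x, (0 : ℝ))) contDiff_fst)
      ((sm_iff_contDiff.2 contDiff_snd).smAt _) rfl) (hη.comp (x := (x, (0 : ℝ))) contDiff_fst)
  have h2 := smAt_dirDeriv hF (g := fun y : V => (y, 0)) (h := fun _ => (0, 1)) (by fun_prop)
    (by fun_prop) rfl
  refine h2.congr (Filter.Eventually.of_forall fun y => ?_)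
  simp [dirDeriv, bracket]

theorem dirDeriv_bracket {ξ η : V → E} {x : V} (hξ : SmAt ξ x) (hη : SmAt η x) (v : V) :
    dirDeriv (fun y => φ.bracket (ξ y) (η y)) x v =
      φ.bracket (dirDeriv ξ x v) (η x) + φ.bracket (ξ x) (dirDeriv η x v) := by
  let L (η : E) : E →ₗ[ℝ] E := ⟨⟨fun ξ => φ.bracket ξ η, fun a b => φ.bracket_add_left a b η⟩,
    fun a b => φ.bracket_smul_left a b η⟩
  let R (ξ : E) : E →ₗ[ℝ] E := ⟨⟨fun η => φ.bracket ξ η, fun a b => φ.bracket_add_right ξ a b⟩,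
    fun a b => φ.bracket_smul_right a ξ b⟩
  have hL (η : E) : DSmooth (L η) := fun _ _ hp => sm_iff_isPlot.1 (sm_of_smAt fun x =>
    φ.smAt_bracket ((sm_iff_isPlot.2 hp).smAt x) (smAt_const η x))
  have hR (ξ : E) : DSmooth (R ξ) := fun _ _ hp => sm_iff_isPlot.1 (sm_of_smAt fun x =>
    φ.smAt_bracket (smAt_const ξ x) ((sm_iff_isPlot.2 hp).smAt x))
  rw [dirDeriv_diag (f := fun y z => φ.bracket (ξ y) (η z))
    (φ.smAt_bracket (hξ.comp (x := (x, x)) contDiff_fst) (hη.comp (x := (x, x)) contDiff_snd))]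
  exact congrArg₂ _ (dirDeriv_map hξ (hL _) v) (dirDeriv_map hη (hR _) v)

/-- Differentiate `Ad(h) Ad(c(t)) = Ad(h c(t) h⁻¹) Ad(h)` at `t = 0`. -/
theorem Ad_bracket (h : H) (ξ η : E) :
    φ.Ad h (φ.bracket ξ η) = φ.bracket (φ.Ad h ξ) (φ.Ad h η) := by
  have hc := φ.smAt_curve_id ξ
  have h1 := φ.dirDeriv_Ad_const hc (φ.curve_zero ξ) η 1
  have h2 := φ.dirDeriv_Ad_const (smAt_mul (smAt_mul (smAt_const h 0) hc) (smAt_const h⁻¹ 0))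
    (by simp [curve_zero]) (φ.Ad h η) 1
  rw [φ.dirDeriv_conj hc (φ.curve_zero ξ), dirDeriv_curve] at h2
  rw [dirDeriv_curve] at h1
  rw [← h1, ← h2]
  have h3 := dirDeriv_map (φ.smAt_Ad hc (smAt_const η 0)) (φ.dSmooth_AdLinear h) 1
  refine h3.symm.trans (congrArg (fun f => dirDeriv f (0 : ℝ) 1) (funext fun t => ?_))
  change φ.Ad h (φ.Ad (φ.curve ξ t) η) = _
  rw [← Ad_mul, ← Ad_mul]
  simp

/-- The left logarithmic derivative, on parameter spaces which are normed spaces. -/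
noncomputable def logDer {V : Type*} [NormedAddCommGroup V] [NormedSpace ℝ V]
    (h : V → H) (x v : V) : E := dirDeriv (fun z => φ.toFun ((h x)⁻¹ * h z)) x v

theorem logDeriv_eq_logDer {m : ℕ} (h : Euc m → H) : φ.logDeriv h = φ.logDer h := rfl

theorem smAt_inv_mul {h : V → H} {x : V} (hh : SmAt h x) :
    SmAt (fun z : V × V => φ.toFun ((h z.1)⁻¹ * h z.2)) (x, x) :=
  φ.smAt_chart (smAt_mul (smAt_inv (hh.comp (x := (x, x)) contDiff_fst))
    (hh.comp (x := (x, x)) contDiff_snd)) (by simpa using φ.one_mem)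

theorem smAt_logDer {h : V → H} {x : V} (hh : SmAt h x) (v : V) :
    SmAt (fun y => φ.logDer h y v) x :=
  (smAt_dirDeriv_snd (F := fun y z => φ.toFun ((h y)⁻¹ * h z)) (φ.smAt_inv_mul hh) v).comp
    (g := fun y : V => (y, y)) (by fun_prop)

theorem smAt_inv_mul_const {h : V → H} {x : V} (hh : SmAt h x) :
    SmAt (fun z : V => φ.toFun ((h x)⁻¹ * h z)) x :=
  φ.smAt_chart (smAt_mul (smAt_const _ x) hh) (by simpa using φ.one_mem)

theorem logDer_add {h : V → H} {x : V} (hh : SmAt h x) (v w : V) :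
    φ.logDer h x (v + w) = φ.logDer h x v + φ.logDer h x w :=
  dirDeriv_add_right (φ.smAt_inv_mul_const hh) v w

theorem logDer_smul {h : V → H} {x : V} (hh : SmAt h x) (a : ℝ) (v : V) :
    φ.logDer h x (a • v) = a • φ.logDer h x v :=
  dirDeriv_smul_right (φ.smAt_inv_mul_const hh) a v

theorem logDer_congr {h h' : V → H} {x : V} (e : h =ᶠ[𝓝 x] h') (v : V) :
    φ.logDer h x v = φ.logDer h' x v := by
  rw [logDer, logDer, e.self_of_nhds]
  exact dirDeriv_congr (e.fun_comp fun g => φ.toFun ((h' x)⁻¹ * g)) v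

theorem logDer_comp {W : Type*} [NormedAddCommGroup W] [NormedSpace ℝ W] [FiniteDimensional ℝ W]
    {h : V → H} {f : W → V} {x : W} (hh : SmAt h (f x)) (hf : ContDiff ℝ ∞ f) (v : W) :
    φ.logDer (fun y => h (f y)) x v = φ.logDer h (f x) (fderiv ℝ f x v) :=
  dirDeriv_comp (φ.smAt_inv_mul_const hh) hf v

/-- Factor `(g(x)h(x))⁻¹ g(z)h(z)` as the `h(x)⁻¹`-conjugate of `g(x)⁻¹g(z)` times `h(x)⁻¹h(z)`;
velocities of products at `1` add. -/
theorem logDer_mul {g h : V → H} {x : V} (hg : SmAt g x) (hh : SmAt h x) (v : V) :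
    φ.logDer (fun y => g y * h y) x v = φ.Ad (h x)⁻¹ (φ.logDer g x v) + φ.logDer h x v := by
  have h1 := φ.dirDeriv_chart_mul (x := x)
    (a := fun z => (h x)⁻¹ * ((g x)⁻¹ * g z) * ((h x)⁻¹)⁻¹) (b := fun z => (h x)⁻¹ * h z)
    (smAt_mul (smAt_mul (smAt_const _ x) (smAt_mul (smAt_const _ x) hg)) (smAt_const _ x))
    (smAt_mul (smAt_const _ x) hh) (by simp) (by simp) v
  rw [φ.dirDeriv_conj (smAt_mul (smAt_const _ x) hg) (by simp)] at h1
  rw [logDer, logDer, logDer, ← h1]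
  simp only [inv_inv, mul_inv_rev, mul_assoc, mul_inv_cancel_left]

theorem logDer_const_mul (g : H) (h : V → H) (x v : V) :
    φ.logDer (fun y => g * h y) x v = φ.logDer h x v := by
  simp [logDer, mul_assoc]

/-- The Maurer-Cartan equation. -/
theorem dirDeriv_logDer {h : V → H} {x : V} (hh : SmAt h x) (v w : V) :
    dirDeriv (fun y => φ.logDer h y w) x v - dirDeriv (fun y => φ.logDer h y v) x w +
      φ.bracket (φ.logDer h x v) (φ.logDer h x w) = 0 := by
  -- Left translation does not change the logarithmic derivative, so the map may be assumed to take
  -- the value `1` at `x`.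
  let k : V → H := fun y => (h x)⁻¹ * h y
  have hk : SmAt k x := smAt_mul (smAt_const _ x) hh
  have hkx : k x = 1 := by simp [k]
  have hl (y v : V) : φ.logDer h y v = φ.logDer k y v := (φ.logDer_const_mul _ h y v).symm
  simp only [hl]
  have hθ (v : V) : φ.logDer k x v = dirDeriv (fun y => φ.toFun (k y)) x v := by
    simp [logDer, hkx]
  have hs : SmAt (fun z : V × V => φ.toFun (k z.1 * k z.2)) (x, x) :=
    φ.smAt_chart (smAt_mul (hk.comp (x := (x, x)) contDiff_fst)
      (hk.comp (x := (x, x)) contDiff_snd)) (by simpa [hkx] using φ.one_mem)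
  -- The point `y` enters both as base point of the inverse and as point of evaluation. The first
  -- contributes minus the mixed derivative occurring in `bracket_dirDeriv`, the second a second
  -- derivative of the chart of `k`, symmetric in `v` and `w`.
  have key (v w : V) : dirDeriv (fun y => φ.logDer k y w) x v =
      -dirDeriv (fun y => dirDeriv (fun z => φ.toFun (k y * k z)) x w) x v +
        dirDeriv (fun y => dirDeriv (fun z => φ.toFun (k z)) y w) x v := by
    have h1 := smAt_dirDeriv_snd (F := fun y z => φ.toFun ((k y)⁻¹ * k z)) (φ.smAt_inv_mul hk) w
    have h2 := dirDeriv_diag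
      (f := fun y y' => dirDeriv (fun z => φ.toFun ((k y)⁻¹ * k z)) y' w) h1 v
    refine h2.trans (congrArg₂ _ ?_ (by simp [hkx]))
    rw [dirDeriv_partial_comm (F := fun y z => φ.toFun ((k y)⁻¹ * k z)) (φ.smAt_inv_mul hk),
      dirDeriv_partial_comm (F := fun y z => φ.toFun (k y * k z)) hs]
    have hev : (fun z => dirDeriv (fun y => φ.toFun ((k y)⁻¹ * k z)) x v) =ᶠ[𝓝 x]
        fun z => -dirDeriv (fun y => φ.toFun (k y * k z)) x v := by
      filter_upwards [hk.eventually_mem φ.open_source (by rw [hkx]; exact φ.one_mem)] with z hz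
      exact φ.dirDeriv_inv_mul_left hk hkx hz v
    rw [dirDeriv_congr hev, dirDeriv_neg]
    exact (smAt_dirDeriv_fst (F := fun y z => φ.toFun (k y * k z)) hs v).comp
      (g := fun z : V => (x, z)) (by fun_prop)
  rw [hθ, hθ, φ.bracket_dirDeriv hk hkx, key v w, key w v,
    dirDeriv_dirDeriv_comm (φ.smAt_chart hk (by rw [hkx]; exact φ.one_mem)) v w]
  abel

/-- Writing `h(y) = h(x) k(y)` gives `Ad(h(y)⁻¹) = Ad(k(y)⁻¹) Ad(h(x)⁻¹)` with `k(x) = 1`; the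
derivative of `Ad ∘ k⁻¹` at `x` is a bracket with minus the velocity of `k`. -/
theorem dirDeriv_Ad_inv {h : V → H} {ξ : V → E} {x : V} (hh : SmAt h x) (hξ : SmAt ξ x) (v : V) :
    dirDeriv (fun y => φ.Ad (h y)⁻¹ (ξ y)) x v =
      φ.Ad (h x)⁻¹ (dirDeriv ξ x v) - φ.bracket (φ.logDer h x v) (φ.Ad (h x)⁻¹ (ξ x)) := by
  have hF : SmAt (fun z : V × V => φ.Ad (h z.1)⁻¹ (ξ z.2)) (x, x) :=
    φ.smAt_Ad (smAt_inv (hh.comp (x := (x, x)) contDiff_fst)) (hξ.comp (x := (x, x)) contDiff_snd)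
  rw [dirDeriv_diag (f := fun y z => φ.Ad (h y)⁻¹ (ξ z)) hF, add_comm, sub_eq_add_neg]
  refine congrArg₂ _ (dirDeriv_map hξ (φ.dSmooth_AdLinear (h x)⁻¹) v) ?_
  have hk : SmAt (fun y => (h x)⁻¹ * h y) x := smAt_mul (smAt_const _ x) hh
  have h1 := φ.dirDeriv_Ad_const (smAt_inv hk) (by simp) (φ.Ad (h x)⁻¹ (ξ x)) v
  rw [φ.dirDeriv_chart_inv hk (by simp), bracket_neg_left] at h1
  simp only [← Ad_mul] at h1
  simpa [logDer] using h1

/-- The curvature of a Lie algebra valued `1`-form on a normed space. -/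
noncomputable def curv {V : Type*} [NormedAddCommGroup V] [NormedSpace ℝ V]
    (A : V → V → E) (x v w : V) : E :=
  dirDeriv (fun y => A y w) x v - dirDeriv (fun y => A y v) x w + φ.bracket (A x v) (A x w)

theorem curv_congr {A B : V → V → E} {x : V} (h : ∀ᶠ y in 𝓝 x, A y = B y) :
    φ.curv A x = φ.curv B x := by
  funext v w
  have h' (w : V) : (fun y => A y w) =ᶠ[𝓝 x] fun y => B y w := h.mono fun y hy => congrFun hy w
  rw [curv, curv, dirDeriv_congr (h' w), dirDeriv_congr (h' v), h.self_of_nhds]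

/-- The derivatives of `Ad(h⁻¹)` produce brackets of `h⁻¹dh` with `Ad(h⁻¹)A`, which cancel the cross
terms of the quadratic part; what involves `h⁻¹dh` alone vanishes by the Maurer–Cartan equation. -/
theorem curv_gauge {A : V → V → E} {h : V → H} {x : V} (hA : ∀ v, SmAt (fun y => A y v) x)
    (hh : SmAt h x) (v w : V) :
    φ.curv (fun y v => φ.Ad (h y)⁻¹ (A y v) + φ.logDer h y v) x v w =
      φ.Ad (h x)⁻¹ (φ.curv A x v w) := by
  have key (v w : V) : dirDeriv (fun y => φ.Ad (h y)⁻¹ (A y w) + φ.logDer h y w) x v =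
      φ.Ad (h x)⁻¹ (dirDeriv (fun y => A y w) x v) -
        φ.bracket (φ.logDer h x v) (φ.Ad (h x)⁻¹ (A x w)) +
        dirDeriv (fun y => φ.logDer h y w) x v := by
    rw [dirDeriv_add (φ.smAt_Ad (smAt_inv hh) (hA w)) (φ.smAt_logDer hh w),
      φ.dirDeriv_Ad_inv hh (hA w)]
  have hMC := φ.dirDeriv_logDer hh v w
  rw [curv, curv, key, key, Ad_add, Ad_sub, Ad_bracket, bracket_add_left, bracket_add_right,
    bracket_add_right, φ.bracket_antisymm (φ.Ad (h x)⁻¹ (A x v)) (φ.logDer h x w),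
    ← sub_eq_zero, ← hMC]
  abel

end LieChart

end Lie

/-! ### Smoothness of families of alternating maps. -/

section AlternatingSmooth

variable {V W : Type*} [NormedAddCommGroup V] [NormedSpace ℝ V] [FiniteDimensional ℝ V]
  [NormedAddCommGroup W] [NormedSpace ℝ W]

/-- A family of alternating maps is smooth as soon as its evaluations are. -/
theorem contDiff_alternating {n : ℕ} {α : W → V [⋀^Fin n]→L[ℝ] ℝ}
    (h : ∀ v, ContDiff ℝ ∞ fun x => α x v) : ContDiff ℝ ∞ α := by
  let b := Module.finBasis ℝ V
  let T : (V [⋀^Fin n]→L[ℝ] ℝ) →ₗ[ℝ] ((Fin n → Fin (Module.finrank ℝ V)) → ℝ) :=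
    { toFun := fun β f => β fun i => b (f i)
      map_add' := fun _ _ => rfl
      map_smul' := fun _ _ => rfl }
  -- Values on basis vectors determine an alternating map, so the family is recovered from finitely
  -- many smooth functions by a linear left inverse, continuous in finite dimension.
  have hT : LinearMap.ker T = ⊥ := by
    refine LinearMap.ker_eq_bot'.2 fun β hα => ?_
    have : β.toAlternatingMap = 0 := Module.Basis.ext_alternating b fun f _ => congrFun hα f
    exact ContinuousAlternatingMap.ext fun v => congrArg (fun β => β v) this
  obtain ⟨S, hS⟩ := T.exists_leftInverse_of_injective hT
  have h1 : ContDiff ℝ ∞ fun x => T (α x) := contDiff_pi.2 fun f => h fun i => b (f i)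
  have h2 := (LinearMap.toContinuousLinearMap S).contDiff.comp h1
  convert h2 using 1
  funext x
  exact (LinearMap.congr_fun hS (α x)).symm

end AlternatingSmooth

/-! ### Signed sums over permutations: the combinatorics of closedness. -/

section Permutations

/-- A permutation of `n + 1` letters amounts to the image `i` of `0` and a permutation of the rest;
moving `i` to the front costs the sign `(-1)^i`. -/
theorem sum_removeNth_perm {V : Type*} {n : ℕ} (G : (Fin (n + 1) → V) → ℝ) (v : Fin (n + 1) → V) :
    ∑ i : Fin (n + 1), (-1 : ℝ) ^ (i : ℕ) * ∑ τ : Equiv.Perm (Fin n),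
      ((Equiv.Perm.sign τ : ℤ) : ℝ) * G (Fin.cons (v i) fun j => i.removeNth v (τ j)) =
    ∑ ρ : Equiv.Perm (Fin (n + 1)), ((Equiv.Perm.sign ρ : ℤ) : ℝ) * G fun j => v (ρ j) := by
  simp only [Finset.mul_sum]
  rw [← Fintype.sum_prod_type' (f := fun (i : Fin (n + 1)) (τ : Equiv.Perm (Fin n)) =>
    (-1 : ℝ) ^ (i : ℕ) * (((Equiv.Perm.sign τ : ℤ) : ℝ) *
      G (Fin.cons (v i) fun j => i.removeNth v (τ j))))]
  let e : Fin (n + 1) × Equiv.Perm (Fin n) → Equiv.Perm (Fin (n + 1)) := fun z =>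
    (Fin.cycleRange z.1).symm * Equiv.Perm.decomposeFin.symm (0, z.2)
  have e0 (z) : e z 0 = z.1 := by
    simp [e]
  have es (z) (j : Fin n) : e z j.succ = z.1.succAbove (z.2 j) := by
    simp [e]
  have he : Function.Bijective e := by
    refine (Fintype.bijective_iff_injective_and_card e).2 ⟨fun z z' h => ?_, ?_⟩
    · have h0 : z.1 = z'.1 := by rw [← e0 z, h, e0]
      refine Prod.ext h0 (Equiv.ext fun j => ?_)
      have := es z j
      rw [h, es z' j, h0] at this
      exact (Fin.succAbove_right_injective this).symm
    · rw [Fintype.card_prod, Fintype.card_perm, Fintype.card_perm]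
      simp [Nat.factorial_succ]
  refine he.sum_comp (fun ρ => ((Equiv.Perm.sign ρ : ℤ) : ℝ) * G fun j => v (ρ j)) |>.symm ▸ ?_
  refine Fintype.sum_congr _ _ fun z => ?_
  have hs : ((Equiv.Perm.sign (e z) : ℤ) : ℝ) = (-1 : ℝ) ^ (z.1 : ℕ) *
      ((Equiv.Perm.sign z.2 : ℤ) : ℝ) := by
    simp only [e, Equiv.Perm.sign_mul, Equiv.Perm.sign_symm, Fin.sign_cycleRange,
      Equiv.Perm.decomposeFin.symm_sign]
    simp
  have hv : (fun j => v (e z j)) = Fin.cons (v z.1) fun j => z.1.removeNth v (z.2 j) := by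
    funext j
    refine Fin.cases ?_ (fun j => ?_) j
    · rw [e0]; rfl
    · rw [es]; rfl
  rw [hs, hv, mul_assoc]

/-- Reindexing by `s` or `s²` preserves signs, since `s` is a product of two transpositions. Three
times the sum is therefore a sum of cyclic sums, each zero. -/
theorem sum_perm_cyclic_eq_zero {V : Type*} {n : ℕ} {G : (Fin n → V) → ℝ} {a b c : Fin n}
    (hab : a ≠ b) (hbc : b ≠ c)
    (hG : ∀ w : Fin n → V, G w +
      G (fun j => w ((Equiv.swap a b * Equiv.swap b c) j)) +
      G (fun j => w ((Equiv.swap a b * Equiv.swap b c) ((Equiv.swap a b * Equiv.swap b c) j))) = 0)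
    (v : Fin n → V) :
    ∑ ρ : Equiv.Perm (Fin n), ((Equiv.Perm.sign ρ : ℤ) : ℝ) * G (fun j => v (ρ j)) = 0 := by
  set s := Equiv.swap a b * Equiv.swap b c with hs
  have hsign : Equiv.Perm.sign s = 1 := by
    rw [hs, Equiv.Perm.sign_mul, Equiv.Perm.sign_swap hab, Equiv.Perm.sign_swap hbc]
    rfl
  set S := fun ρ : Equiv.Perm (Fin n) => ((Equiv.Perm.sign ρ : ℤ) : ℝ) * G (fun j => v (ρ j))
  have h1 : ∑ ρ, S (ρ * s) = ∑ ρ, S ρ := Equiv.sum_comp (Equiv.mulRight s) S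
  have h2 : ∑ ρ, S (ρ * s * s) = ∑ ρ, S (ρ * s) :=
    Equiv.sum_comp (Equiv.mulRight s) fun ρ => S (ρ * s)
  have h3 : ∑ ρ, (S ρ + S (ρ * s) + S (ρ * s * s)) = 0 := by
    refine Finset.sum_eq_zero fun ρ _ => ?_
    have := hG fun j => v (ρ j)
    simp only [S, Equiv.Perm.sign_mul, hsign, mul_one, ← mul_add]
    exact mul_eq_zero_of_right _ this
  rw [Finset.sum_add_distrib, Finset.sum_add_distrib, h2, h1] at h3
  linarith

variable {V E : Type*} [AddCommGroup E] [Module ℝ E] {r : ℕ}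
  (P : MultilinearMap ℝ (fun _ : Fin r => E) ℝ)

/-- The algebraic form of the Bianchi argument: if the derivative `T` of `F` has vanishing cyclic
sums, then the exterior derivative of `P(F,…,F)` vanishes. -/
theorem sum_polyForm_deriv_eq_zero (F : V → V → E) (T : V → V → V → E)
    (hT : ∀ u v w, T u v w + T v w u + T w u v = 0) (v : Fin (2 * r + 1) → V) :
    ∑ i : Fin (2 * r + 1), (-1 : ℝ) ^ (i : ℕ) * ((1 / 2 : ℝ) ^ r *
      ∑ τ : Equiv.Perm (Fin (2 * r)), ((Equiv.Perm.sign τ : ℤ) : ℝ) * ∑ j₀ : Fin r,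
        P (Function.update
          (fun j : Fin r => F (i.removeNth v (τ ⟨2 * (j : ℕ), by omega⟩))
            (i.removeNth v (τ ⟨2 * (j : ℕ) + 1, by omega⟩))) j₀
          (T (v i) (i.removeNth v (τ ⟨2 * (j₀ : ℕ), by omega⟩))
            (i.removeNth v (τ ⟨2 * (j₀ : ℕ) + 1, by omega⟩))))) = 0 := by
  let G (j₀ : Fin r) (w : Fin (2 * r + 1) → V) : ℝ :=
    P (Function.update
      (fun j : Fin r => F (w (Fin.succ ⟨2 * (j : ℕ), by omega⟩))
        (w (Fin.succ ⟨2 * (j : ℕ) + 1, by omega⟩))) j₀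
      (T (w 0) (w (Fin.succ ⟨2 * (j₀ : ℕ), by omega⟩)) (w (Fin.succ ⟨2 * (j₀ : ℕ) + 1, by omega⟩))))
  have key (j₀ : Fin r) : ∑ ρ : Equiv.Perm (Fin (2 * r + 1)),
      ((Equiv.Perm.sign ρ : ℤ) : ℝ) * G j₀ (fun j => v (ρ j)) = 0 := by
    let a : Fin (2 * r + 1) := Fin.succ ⟨2 * (j₀ : ℕ), by omega⟩
    let b : Fin (2 * r + 1) := Fin.succ ⟨2 * (j₀ : ℕ) + 1, by omega⟩
    have h0a : (0 : Fin (2 * r + 1)) ≠ a := (Fin.succ_ne_zero _).symm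
    have h0b : (0 : Fin (2 * r + 1)) ≠ b := (Fin.succ_ne_zero _).symm
    have hab : a ≠ b := by simp [a, b, Fin.ext_iff]
    refine sum_perm_cyclic_eq_zero h0a hab (fun w => ?_) v
    -- The cycle `0 → a → b → 0` moves only the direction of differentiation and the two arguments
    -- of the differentiated factor. The other factors of `P` stay fixed, so linearity in slot `j₀`
    -- brings the cyclic sum of `T` inside.
    set s := Equiv.swap 0 a * Equiv.swap a b with hs
    have s0 : s 0 = a := by simp [hs, Equiv.swap_apply_of_ne_of_ne h0a h0b]
    have sa : s a = b := by simp [hs, Equiv.swap_apply_of_ne_of_ne h0b.symm hab.symm]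
    have sb : s b = 0 := by simp [hs]
    have sne (c) (h1 : c ≠ 0) (h2 : c ≠ a) (h3 : c ≠ b) : s c = c := by
      simp [hs, Equiv.swap_apply_of_ne_of_ne h2 h3, Equiv.swap_apply_of_ne_of_ne h1 h2]
    have hother (w : Fin (2 * r + 1) → V) (ξ : E) : P (Function.update
        (fun j : Fin r => F (w (s (Fin.succ ⟨2 * (j : ℕ), by omega⟩)))
          (w (s (Fin.succ ⟨2 * (j : ℕ) + 1, by omega⟩)))) j₀ ξ) = P (Function.update
        (fun j : Fin r => F (w (Fin.succ ⟨2 * (j : ℕ), by omega⟩))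
          (w (Fin.succ ⟨2 * (j : ℕ) + 1, by omega⟩))) j₀ ξ) := by
      congr 1
      funext j
      by_cases hj : j = j₀
      · subst hj; simp
      · have hj' : (j : ℕ) ≠ j₀ := fun h => hj (Fin.ext h)
        rw [Function.update_of_ne hj, Function.update_of_ne hj, sne, sne]
        all_goals simp [a, b, Fin.ext_iff]
        all_goals omega
    have hP3 : G j₀ w + G j₀ (fun j => w (s j)) + G j₀ (fun j => w (s (s j))) =
        P (Function.update (fun j : Fin r => F (w (Fin.succ ⟨2 * (j : ℕ), by omega⟩))
          (w (Fin.succ ⟨2 * (j : ℕ) + 1, by omega⟩))) j₀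
          (T (w 0) (w a) (w b) + T (w a) (w b) (w 0) + T (w b) (w 0) (w a))) := by
      rw [P.map_update_add, P.map_update_add]
      refine congrArg₂ _ (congrArg₂ _ rfl ?_) ?_
      · change P (Function.update _ j₀ (T (w (s 0)) (w (s a)) (w (s b)))) = _
        rw [hother, s0, sa, sb]
      · change P (Function.update _ j₀ (T (w (s (s 0))) (w (s (s a))) (w (s (s b))))) = _
        rw [hother (fun j => w (s j)), hother, s0, sa, sb, s0]
    rw [hP3, hT, P.map_update_zero]
  have h2 := Finset.sum_congr (rfl : (Finset.univ : Finset (Fin r)) = Finset.univ)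
    fun j₀ _ => (sum_removeNth_perm (G j₀) v).trans (key j₀)
  rw [Finset.sum_const_zero, Finset.sum_comm] at h2
  rw [← mul_zero ((1 / 2 : ℝ) ^ r), ← h2, Finset.mul_sum]
  refine Finset.sum_congr rfl fun i _ => ?_
  rw [← Finset.mul_sum, Finset.sum_comm, mul_left_comm]
  simp only [Finset.mul_sum]
  rfl

end Permutations

/-! ### Multilinearity of `P(F,…,F)`. -/

section PolyForm

variable {V E : Type*} [AddCommGroup V] [Module ℝ V] [AddCommGroup E] [Module ℝ E] {r : ℕ}
  (P : MultilinearMap ℝ (fun _ : Fin r => E) ℝ)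

/-- Each argument belongs to exactly one of the `r` pairs, and its parity tells whether it is the
first or second entry; so one factor of `P` changes, linearly when `F` is bilinear. -/
theorem update_pair (F : V → V → E) (v : Fin (2 * r) → V) (i : Fin (2 * r)) :
    ∃ (j₀ : Fin r) (L : V → E), (∀ x, (fun j : Fin r =>
      F (Function.update v i x ⟨2 * (j : ℕ), by omega⟩)
        (Function.update v i x ⟨2 * (j : ℕ) + 1, by omega⟩)) =
      Function.update (fun j : Fin r => F (v ⟨2 * (j : ℕ), by omega⟩)
        (v ⟨2 * (j : ℕ) + 1, by omega⟩)) j₀ (L x)) ∧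
      (L = (fun x => F x (v ⟨2 * (j₀ : ℕ) + 1, by omega⟩)) ∨
        L = F (v ⟨2 * (j₀ : ℕ), by omega⟩)) := by
  obtain ⟨i, hi⟩ := i
  rcases Nat.even_or_odd' i with ⟨k, rfl | rfl⟩
  · refine ⟨⟨k, by omega⟩, fun x => F x (v ⟨2 * k + 1, by omega⟩), fun x => ?_, Or.inl rfl⟩
    funext j
    by_cases hj : (j : ℕ) = k
    · subst hj
      simp [Function.update_of_ne, Fin.ext_iff]
    · rw [Function.update_of_ne, Function.update_of_ne, Function.update_of_ne]
      all_goals simp [Fin.ext_iff]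
      all_goals omega
  · refine ⟨⟨k, by omega⟩, F (v ⟨2 * k, by omega⟩), fun x => ?_, Or.inr rfl⟩
    funext j
    by_cases hj : (j : ℕ) = k
    · subst hj
      simp [Function.update_of_ne, Fin.ext_iff]
    · rw [Function.update_of_ne, Function.update_of_ne, Function.update_of_ne]
      all_goals simp [Fin.ext_iff]
      all_goals omega

/-- `P(F,…,F)` before antisymmetrisation. -/
def polyMultilinear (F : V → V → E) (h1 : ∀ w, IsLinearMap ℝ fun v => F v w)
    (h2 : ∀ v, IsLinearMap ℝ (F v)) : MultilinearMap ℝ (fun _ : Fin (2 * r) => V) ℝ where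
  toFun v := P fun j : Fin r => F (v ⟨2 * (j : ℕ), by omega⟩) (v ⟨2 * (j : ℕ) + 1, by omega⟩)
  map_update_add' v i x y := by
    rename_i inst
    -- The axiom supplies an arbitrary decidable equality, replaced by the standard one used in
    -- `update_pair`.
    rw [Subsingleton.elim inst (instDecidableEqFin _)]
    obtain ⟨j₀, L, hL, h⟩ := update_pair F v i
    have hadd : L (x + y) = L x + L y := by
      rcases h with rfl | rfl
      · exact (h1 _).map_add x y
      · exact (h2 _).map_add x y
    rw [hL, hL, hL, hadd, P.map_update_add]
  map_update_smul' v i c x := by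
    rename_i inst
    rw [Subsingleton.elim inst (instDecidableEqFin _)]
    obtain ⟨j₀, L, hL, h⟩ := update_pair F v i
    have hsmul : L (c • x) = c • L x := by
      rcases h with rfl | rfl
      · exact (h1 _).map_smul c x
      · exact (h2 _).map_smul c x
    rw [hL, hL, hsmul, P.map_update_smul]

theorem polyForm_eq_alternatization (F : V → V → E) (h1 : ∀ w, IsLinearMap ℝ fun v => F v w)
    (h2 : ∀ v, IsLinearMap ℝ (F v)) (v : Fin (2 * r) → V) :
    polyForm P F v = ((1 / 2 : ℝ) ^ r •
      MultilinearMap.alternatization (polyMultilinear P F h1 h2)) v := by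
  rw [polyForm, AlternatingMap.smul_apply, MultilinearMap.alternatization_apply, smul_eq_mul]
  congr 1
  refine Finset.sum_congr rfl fun τ _ => ?_
  rw [Units.smul_def, zsmul_eq_mul]
  rfl

end PolyForm

/-! ### Lie algebra valued 1-forms: pull-back of curvature and the Bianchi identity. -/

section OneForms

variable {V W E : Type*} [NormedAddCommGroup V] [NormedSpace ℝ V] [FiniteDimensional ℝ V]
  [NormedAddCommGroup W] [NormedSpace ℝ W] [FiniteDimensional ℝ W]
  [AddCommGroup E] [Module ℝ E] [DiffeologicalSpace E] [ConvenientSpace E]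

/-- Expansion in a basis of the finite-dimensional `V` gives a finite sum of smooth coefficients
times smooth coordinates. -/
theorem sm_uncurry {A : W → V → E} (h1 : ∀ x, IsLinearMap ℝ (A x)) (h2 : ∀ v, Sm fun x => A x v) :
    Sm fun z : W × V => A z.1 z.2 := by
  let b := Module.finBasis ℝ V
  have h : (fun z : W × V => A z.1 z.2) = fun z => ∑ i, b.coord i z.2 • A z.1 (b i) := by
    funext z
    have := congrArg (h1 z.1).mk' (b.sum_repr z.2)
    rw [map_sum] at this
    simp only [map_smul] at this
    exact this.symm
  rw [h]
  refine sm_of_smAt fun z => smAt_sum _ fun i _ => smAt_smul ?_ ?_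
  · exact (sm_iff_contDiff.2
      ((LinearMap.toContinuousLinearMap (b.coord i)).contDiff.comp contDiff_snd)).smAt z
  · exact ((h2 (b i)).comp contDiff_fst).smAt z

theorem sm_linear {L : V → E} (hL : IsLinearMap ℝ L) : Sm L :=
  (sm_uncurry (W := V) (A := fun _ => L) (fun _ => hL) fun _ => sm_const _).comp
    (g := fun v => (v, v)) (by fun_prop)

theorem dirDeriv_linear {L : V → E} (hL : IsLinearMap ℝ L) (x v : V) : dirDeriv L x v = L v := by
  refine dirDeriv_eq_of_forall fun ℓ _ => ?_
  have : (fun t : ℝ => ℓ (L (x + t • v))) = fun t => ℓ (L x) + t * ℓ (L v) := by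
    funext t
    rw [hL.map_add, hL.map_smul, map_add, map_smul, smul_eq_mul]
  rw [this]
  simpa using ((hasDerivAt_id (0 : ℝ)).mul_const (ℓ (L v))).const_add (ℓ (L x))

/-- Smooth Lie algebra valued `1`-forms on a normed space. -/
structure IsOneForm (A : V → V → E) : Prop where
  linear : ∀ x, IsLinearMap ℝ (A x)
  sm : ∀ v, Sm fun x => A x v

theorem IsOneForm.sm_apply {A : V → V → E} (hA : IsOneForm A) {f g : W → V}
    (hf : ContDiff ℝ ∞ f) (hg : ContDiff ℝ ∞ g) : Sm fun x => A (f x) (g x) :=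
  (sm_uncurry hA.linear hA.sm).comp (hf.prodMk hg)

theorem contDiff_fderiv_apply {f : W → V} (hf : ContDiff ℝ ∞ f) (w : W) :
    ContDiff ℝ ∞ fun x => fderiv ℝ f x w :=
  (hf.fderiv_right (m := ∞) (by simp)).clm_apply contDiff_const

variable {H : Type*} [Group H] [DiffeologicalSpace H] [DiffeologicalGroup H] (φ : LieChart H E)

namespace LieChart

theorem sm_curv {A : V → V → E} (hA : IsOneForm A) (v w : V) : Sm fun x => φ.curv A x v w :=
  sm_of_smAt fun x => smAt_add
    (smAt_sub (smAt_dirDeriv ((hA.sm w).smAt x) (g := id) contDiff_id contDiff_const rfl)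
      (smAt_dirDeriv ((hA.sm v).smAt x) (g := id) contDiff_id contDiff_const rfl))
    (φ.smAt_bracket ((hA.sm v).smAt x) ((hA.sm w).smAt x))

theorem curv_antisymm (A : V → V → E) (x v w : V) : φ.curv A x v w = -φ.curv A x w v := by
  rw [curv, curv, φ.bracket_antisymm (A x v)]
  abel

theorem curv_linear_left {A : V → V → E} (hA : IsOneForm A) (x w : V) :
    IsLinearMap ℝ fun v => φ.curv A x v w := by
  constructor
  · intro v v'
    simp only [curv, (hA.linear _).map_add, dirDeriv_add_right ((hA.sm w).smAt x),
      dirDeriv_add ((hA.sm v).smAt x) ((hA.sm v').smAt x), bracket_add_left]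
    abel
  · intro c v
    simp only [curv, (hA.linear _).map_smul, dirDeriv_smul_right ((hA.sm w).smAt x),
      dirDeriv_const_smul ((hA.sm v).smAt x), bracket_smul_left, smul_add, smul_sub]

theorem curv_linear_right {A : V → V → E} (hA : IsOneForm A) (x v : V) :
    IsLinearMap ℝ (φ.curv A x v) := by
  constructor
  · intro w w'
    rw [curv_antisymm, (φ.curv_linear_left hA x v).map_add, φ.curv_antisymm A x w,
      φ.curv_antisymm A x w']
    abel
  · intro c w
    rw [curv_antisymm, (φ.curv_linear_left hA x v).map_smul, φ.curv_antisymm A x w, smul_neg,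
      neg_neg]

/-- The second summand is symmetric in `v` and `w` and disappears from the curvature; this is why
curvature is natural although first derivatives are not. -/
theorem dirDeriv_pullback {A : V → V → E} (hA : IsOneForm A) {f : W → V} (hf : ContDiff ℝ ∞ f)
    (x v w : W) : dirDeriv (fun y => A (f y) (fderiv ℝ f y w)) x v =
      dirDeriv (fun y => A y (fderiv ℝ f x w)) (f x) (fderiv ℝ f x v) +
        A (f x) (fderiv ℝ (fderiv ℝ f) x v w) := by
  have hF : Sm fun z : W × W => A (f z.1) (fderiv ℝ f z.2 w) :=
    hA.sm_apply (hf.comp contDiff_fst) ((contDiff_fderiv_apply hf w).comp contDiff_snd)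
  rw [dirDeriv_diag (f := fun y z => A (f y) (fderiv ℝ f z w)) (hF.smAt _)]
  refine congrArg₂ _ (dirDeriv_comp ((hA.sm _).smAt _) hf v) ?_
  rw [dirDeriv_comp (f := A (f x)) (g := fun y => fderiv ℝ f y w)
    ((sm_linear (hA.linear _)).smAt _) (contDiff_fderiv_apply hf w), dirDeriv_linear (hA.linear _)]
  have hd : DifferentiableAt ℝ (fderiv ℝ f) x :=
    (hf.fderiv_right (m := ∞) (by simp)).differentiable (by simp) x
  rw [fderiv_clm_apply hd (by fun_prop)]
  simp

/-- The curvature is compatible with pull-backs. -/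
theorem curv_pullback {A : V → V → E} (hA : IsOneForm A) {f : W → V} (hf : ContDiff ℝ ∞ f)
    (x v w : W) : φ.curv (fun y u => A (f y) (fderiv ℝ f y u)) x v w =
      φ.curv A (f x) (fderiv ℝ f x v) (fderiv ℝ f x w) := by
  have hsymm : fderiv ℝ (fderiv ℝ f) x v w = fderiv ℝ (fderiv ℝ f) x w v :=
    (hf.contDiffAt (x := x)).isSymmSndFDerivAt (by
      rw [minSmoothness_of_isRCLikeNormedField]
      exact WithTop.coe_le_coe.2 (le_top (a := (2 : ℕ∞)))) v w
  rw [curv, curv, dirDeriv_pullback hA hf, dirDeriv_pullback hA hf, hsymm]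
  abel

/-- The Bianchi identity at a point where the connection form vanishes. -/
theorem bianchi_of_eq_zero {A : V → V → E} (hA : IsOneForm A) {x : V} (hx : A x = 0) (u v w : V) :
    dirDeriv (fun y => φ.curv A y v w) x u + dirDeriv (fun y => φ.curv A y w u) x v +
      dirDeriv (fun y => φ.curv A y u v) x w = 0 := by
  have hd (v w : V) : SmAt (fun y => dirDeriv (fun z => A z w) y v) x :=
    smAt_dirDeriv ((hA.sm w).smAt x) (g := id) contDiff_id contDiff_const rfl
  -- The bracket is quadratic in `A`, so its first derivative vanishes where `A` does; only second
  -- derivatives of `A` are left, which cancel cyclically.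
  have key (u v w : V) : dirDeriv (fun y => φ.curv A y v w) x u =
      dirDeriv (fun y => dirDeriv (fun z => A z w) y v) x u -
        dirDeriv (fun y => dirDeriv (fun z => A z v) y w) x u := by
    have hv := (hA.sm v).smAt x
    have hw := (hA.sm w).smAt x
    refine (dirDeriv_add (smAt_sub (hd v w) (hd w v)) (φ.smAt_bracket hv hw) u).trans ?_
    rw [dirDeriv_sub (hd v w) (hd w v), φ.dirDeriv_bracket hv hw, hx]
    simp [bracket_zero_left, bracket_zero_right]
  rw [key, key, key, dirDeriv_dirDeriv_comm ((hA.sm w).smAt x) u v,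
    dirDeriv_dirDeriv_comm ((hA.sm v).smAt x) w u, dirDeriv_dirDeriv_comm ((hA.sm u).smAt x) v w]
  abel

end LieChart

end OneForms

/-! ### Invariant polynomials applied to curvature. -/

section Polynomials

variable {V E H : Type*} [NormedAddCommGroup V] [NormedSpace ℝ V] [FiniteDimensional ℝ V]
  [AddCommGroup E] [Module ℝ E] [DiffeologicalSpace E] [ConvenientSpace E]
  [Group H] [DiffeologicalSpace H] [DiffeologicalGroup H] {φ : LieChart H E}
  {r : ℕ} {P : MultilinearMap ℝ (fun _ : Fin r => E) ℝ} (hP : φ.IsInvariantPolynomial P)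

include hP

namespace LieChart.IsInvariantPolynomial

theorem contDiff {f : Fin r → V → E} (hf : ∀ j, Sm (f j)) :
    ContDiff ℝ ∞ fun x => P fun j => f j x := by
  let e := toEuclidean (E := V)
  have h := (hP.smooth (fun j y => f j (e.symm y)) fun j => hf j _ _ e.symm.contDiff).comp
    e.contDiff
  convert h using 1
  funext x
  simp

theorem dSmooth_toLinearMap (m : Fin r → E) (j : Fin r) : DSmooth (P.toLinearMap m j) := by
  intro n p hp
  refine (hP.smooth (fun i x => Function.update m j (p x) i) fun i => ?_).isPlot
  by_cases hi : i = j
  · subst hi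
    simpa using hp
  · simpa [hi] using isPlot_const

/-- Give each slot its own copy of the variable and differentiate along the diagonal: each partial
derivative is that of a smooth linear functional applied to one factor. -/
theorem fderiv_apply {f : Fin r → V → E} (hf : ∀ j, Sm (f j)) (x v : V) :
    fderiv ℝ (fun x => P fun j => f j x) x v =
      ∑ j, P (Function.update (fun j => f j x) j (dirDeriv (f j) x v)) := by
  let g : (Fin r → V) → ℝ := fun z => P fun j => f j (z j)
  have hg : ContDiff ℝ ∞ g := hP.contDiff (f := fun j (z : Fin r → V) => f j (z j)) fun j =>
    (hf j).comp (g := fun z : Fin r → V => z j) (by fun_prop)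
  have hgd := (hg.differentiable (by simp) (fun _ => x)).hasFDerivAt
  have h1 : HasFDerivAt (fun x => P fun j => f j x)
      ((fderiv ℝ g fun _ => x).comp (ContinuousLinearMap.pi fun _ => .id ℝ V)) x :=
    HasFDerivAt.comp x (g := g) (f := fun x _ => x) hgd (hasFDerivAt_pi.2 fun _ => hasFDerivAt_id x)
  rw [h1.fderiv]
  have h2 : (ContinuousLinearMap.pi fun _ : Fin r => ContinuousLinearMap.id ℝ V) v =
      ∑ j : Fin r, Pi.single j v := by
    rw [Finset.univ_sum_single fun _ : Fin r => v]
    rfl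
  rw [ContinuousLinearMap.comp_apply, h2, map_sum]
  refine Finset.sum_congr rfl fun j _ => ?_
  have h3 : HasFDerivAt (fun y => g (Function.update (fun _ => x) j y))
      ((fderiv ℝ g fun _ => x).comp (ContinuousLinearMap.pi (Pi.single j (.id ℝ V)))) x :=
    HasFDerivAt.comp x (g := g) (by simpa using hgd) (hasFDerivAt_update (fun _ : Fin r => x) x)
  have h4 : (fun y => g (Function.update (fun _ => x) j y)) = fun y =>
      P.toLinearMap (fun j => f j x) j (f j y) := by
    funext y
    change P _ = P _
    congr 1
    funext i
    by_cases hi : i = j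
    · subst hi; simp
    · simp [hi]
  have h5 := ((hf j).smAt x).apply_dirDeriv v
    (hP.dSmooth_toLinearMap (fun j => f j x) j)
  rw [← h4, h3.fderiv, ContinuousLinearMap.comp_apply] at h5
  refine (congrArg _ ?_).trans h5.symm
  funext i
  by_cases hi : i = j
  · subst hi; simp
  · simp [hi]

theorem contDiff_polyForm {F : V → V → V → E} (hF : ∀ v w, Sm fun x => F x v w)
    (v : Fin (2 * r) → V) : ContDiff ℝ ∞ fun x => polyForm P (F x) v :=
  contDiff_const.mul (ContDiff.sum fun _ _ => contDiff_const.mul (hP.contDiff fun _ => hF _ _))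

theorem fderiv_polyForm {F : V → V → V → E} (hF : ∀ v w, Sm fun x => F x v w)
    (v : Fin (2 * r) → V) (x u : V) : fderiv ℝ (fun x => polyForm P (F x) v) x u =
      (1 / 2 : ℝ) ^ r * ∑ τ : Equiv.Perm (Fin (2 * r)), ((Equiv.Perm.sign τ : ℤ) : ℝ) *
        ∑ j₀ : Fin r, P (Function.update
          (fun j : Fin r => F x (v (τ ⟨2 * (j : ℕ), by omega⟩)) (v (τ ⟨2 * (j : ℕ) + 1, by omega⟩)))
          j₀ (dirDeriv (fun y => F y (v (τ ⟨2 * (j₀ : ℕ), by omega⟩))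
            (v (τ ⟨2 * (j₀ : ℕ) + 1, by omega⟩))) x u)) := by
  have hd (τ : Equiv.Perm (Fin (2 * r))) : DifferentiableAt ℝ (fun x => P fun j : Fin r =>
      F x (v (τ ⟨2 * (j : ℕ), by omega⟩)) (v (τ ⟨2 * (j : ℕ) + 1, by omega⟩))) x :=
    (hP.contDiff fun _ => hF _ _).differentiable (by simp) x
  have h : HasFDerivAt (fun x => polyForm P (F x) v)
      ((1 / 2 : ℝ) ^ r • ∑ τ : Equiv.Perm (Fin (2 * r)), ((Equiv.Perm.sign τ : ℤ) : ℝ) •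
        fderiv ℝ (fun x => P fun j : Fin r => F x (v (τ ⟨2 * (j : ℕ), by omega⟩))
          (v (τ ⟨2 * (j : ℕ) + 1, by omega⟩))) x) x :=
    (HasFDerivAt.fun_sum fun τ _ => (hd τ).hasFDerivAt.const_mul _).const_mul _
  rw [h.fderiv]
  simp only [smul_apply, sum_apply, smul_eq_mul]
  simp only [hP.fderiv_apply fun _ => hF _ _]

theorem polyForm_Ad (g : H) (F : V → V → E) :
    polyForm P (fun v w => φ.Ad g (F v w)) = polyForm P F := by
  funext v
  simp only [polyForm, hP.invariant]

/-- The Chern-Weil form of a `1`-form at a point. -/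
noncomputable def alternating {A : V → V → E} (hA : IsOneForm A) (x : V) :
    V [⋀^Fin (2 * r)]→L[ℝ] ℝ :=
  { ((1 / 2 : ℝ) ^ r • MultilinearMap.alternatization (polyMultilinear P (φ.curv A x)
      (φ.curv_linear_left hA x) (φ.curv_linear_right hA x)) : V [⋀^Fin (2 * r)]→ₗ[ℝ] ℝ) with
    cont := by
      have h : ContDiff ℝ ∞ fun v : Fin (2 * r) → V => polyForm P (φ.curv A x) v := by
        have hs : Sm fun z : V × V => φ.curv A x z.1 z.2 :=
          sm_uncurry (φ.curv_linear_right hA x) fun w => sm_linear (φ.curv_linear_left hA x w)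
        refine contDiff_const.mul (ContDiff.sum fun τ _ => contDiff_const.mul
          (hP.contDiff fun j => hs.comp (g := fun v : Fin (2 * r) → V =>
            (v (τ ⟨2 * (j : ℕ), by omega⟩), v (τ ⟨2 * (j : ℕ) + 1, by omega⟩))) ?_))
        fun_prop
      refine h.continuous.congr fun v => ?_
      exact polyForm_eq_alternatization P _ _ _ v }

theorem alternating_apply {A : V → V → E} (hA : IsOneForm A) (x : V) (v : Fin (2 * r) → V) :
    hP.alternating hA x v = polyForm P (φ.curv A x) v :=
  (polyForm_eq_alternatization P _ _ _ v).symm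

/-- The combinatorial vanishing applied to the derivative of the curvature, whose cyclic sums vanish
by Bianchi where `A` is zero. -/
theorem sum_fderiv_polyForm_eq_zero {A : V → V → E} (hA : IsOneForm A) {x : V} (hx : A x = 0)
    (v : Fin (2 * r + 1) → V) : ∑ i : Fin (2 * r + 1), (-1 : ℝ) ^ (i : ℕ) *
      fderiv ℝ (fun y => polyForm P (φ.curv A y) (i.removeNth v)) x (v i) = 0 := by
  have h := sum_polyForm_deriv_eq_zero P (φ.curv A x)
    (fun u v w => dirDeriv (fun y => φ.curv A y v w) x u) (φ.bianchi_of_eq_zero hA hx) v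
  simp only [hP.fderiv_polyForm (φ.sm_curv hA)]
  exact h

end LieChart.IsInvariantPolynomial

end Polynomials

/-! ### The Chern–Weil form of a connection: construction, closedness, uniqueness. -/

section ChernWeil

open MulOpposite

variable {X Q H E : Type*} [DiffeologicalSpace X] [DiffeologicalSpace Q]
  [Group H] [DiffeologicalSpace H] [DiffeologicalGroup H] [MulAction Hᵐᵒᵖ Q]
  [AddCommGroup E] [Module ℝ E] [DiffeologicalSpace E] [ConvenientSpace E]
  {φ : LieChart H E} {π : Q → X} {m : ℕ}

theorem DForm.ext_apply {n : ℕ} {α β : DForm X n} (h : ∀ m p x v, α.1 m p x v = β.1 m p x v) :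
    α = β :=
  Subtype.ext (funext fun m => funext fun p => funext fun x =>
    ContinuousAlternatingMap.ext fun v => h m p x v)

theorem fderiv_eq_id {V : Type*} [NormedAddCommGroup V] [NormedSpace ℝ V] {ρ : V → V} {x : V}
    (h : ρ =ᶠ[𝓝 x] id) : fderiv ℝ ρ x = .id ℝ V := by
  rw [h.fderiv_eq, fderiv_id]

/-- The value of a form at a point depends only on the plot near that point. -/
theorem DForm.apply_comp_of_eventuallyEq_id {n : ℕ} (α : DForm X n) (p : Plot X m)
    {ρ : Euc m → Euc m} (hρ : ContDiff ℝ ∞ ρ) {x : Euc m} (hx : ρ =ᶠ[𝓝 x] id) :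
    α.1 m ⟨p.1 ∘ ρ, isPlot_reparam p.2 hρ⟩ x = α.1 m p x := by
  rw [α.2.2 m m p ρ hρ]
  ext v
  simp [fderiv_eq_id hx, hx.self_of_nhds]

namespace Connection

variable (Θ : Connection φ Q)

theorem isOneForm (q : Plot Q m) : IsOneForm (Θ.form m q) :=
  ⟨Θ.linear m q, fun v => sm_iff_isPlot.2 (Θ.smooth m q v)⟩

theorem form_comp_eventuallyEq (q : Plot Q m) {ρ : Euc m → Euc m} (hρ : ContDiff ℝ ∞ ρ)
    {x : Euc m} (hx : ρ =ᶠ[𝓝 x] id) :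
    ∀ᶠ y in 𝓝 x, Θ.form m ⟨q.1 ∘ ρ, isPlot_reparam q.2 hρ⟩ y = Θ.form m q y := by
  filter_upwards [hx.eventually_nhds] with y hy
  funext v
  rw [Θ.pullback m m q ρ hρ, fderiv_eq_id hy, hy.self_of_nhds]
  rfl

/-- Two lifts of the same germ differ by a smooth gauge transformation. -/
theorem exists_curv_eq_Ad (hπ : IsPrincipalBundle H π) (q q' : Plot Q m) {x : Euc m}
    (h : ∀ᶠ y in 𝓝 x, π (q.1 y) = π (q'.1 y)) : ∃ g : H, φ.curv (Θ.form m q') x =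
      fun v w => φ.Ad g (φ.curv (Θ.form m q) x v w) := by
  -- Smoothness of division needs plots that share fibres everywhere; precomposing with `ρ` arranges
  -- this without changing the germs at `x`.
  obtain ⟨ρ, hρ, hρx, hρu⟩ := exists_contDiff_eventuallyEq_id h
  choose k hk using fun y => (hπ.fibre _ _).1 (hρu y)
  have hq := isPlot_reparam q.2 hρ
  have hq' := isPlot_reparam q'.2 hρ
  have he : q'.1 ∘ ρ = fun y => op (k y) • (q.1 ∘ ρ) y := funext hk
  have hkp : IsPlot k := hπ.smooth_div hq (he ▸ hq')
  have hkx := (sm_iff_isPlot.2 hkp).smAt x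
  have hform : ∀ᶠ y in 𝓝 x, Θ.form m q' y =
      fun v => φ.Ad (k y)⁻¹ (Θ.form m q y v) + φ.logDer k y v := by
    filter_upwards [Θ.form_comp_eventuallyEq q hρ hρx, Θ.form_comp_eventuallyEq q' hρ hρx]
      with y h1 h2
    rw [← h1, ← h2]
    funext v
    have hsub : (⟨q'.1 ∘ ρ, hq'⟩ : Plot Q m) = ⟨fun y => op (k y) • (q.1 ∘ ρ) y, he ▸ hq'⟩ :=
      Subtype.ext he
    rw [hsub, Θ.gauge m ⟨q.1 ∘ ρ, hq⟩ k hkp (he ▸ hq')]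
    rfl
  refine ⟨(k x)⁻¹, ?_⟩
  rw [φ.curv_congr hform]
  funext v w
  exact φ.curv_gauge (fun v => ((Θ.isOneForm q).sm v).smAt x) hkx v w

/-- There is a local lift along which the connection form vanishes at a given point. -/
theorem exists_lift_form_eq_zero (hπ : IsPrincipalBundle H π) (p : Plot X m) (x : Euc m) :
    ∃ q : Plot Q m, (∀ᶠ y in 𝓝 x, π (q.1 y) = p.1 y) ∧ Θ.form m q x = 0 := by
  obtain ⟨q₀, hq₀, hlift⟩ := hπ.lift p.1 p.2 x
  set A := Θ.form m ⟨q₀, hq₀⟩ with hA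
  have hAo : IsOneForm A := Θ.isOneForm _
  have hξs : Sm fun y => A x (y - x) := (sm_linear (hAo.linear x)).comp (g := fun y => y - x)
    (by fun_prop)
  have hξ : SmAt (fun y => -A x (y - x)) x := smAt_neg (hξs.smAt x)
  have hξ0 : -A x (x - x) = 0 := by rw [sub_self, (hAo.linear x).map_zero, neg_zero]
  -- The gauge transformation takes the value `1` at `x` and has velocity `-A x` there, so the
  -- transformed form at `x` is `A x - A x`.
  obtain ⟨k, hk, hke⟩ := φ.smAt_invFun hξ hξ0
  have hkx : k x = 1 := by
    rw [hke.self_of_nhds]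
    beta_reduce
    rw [hξ0, add_zero, φ.invFun_chart_one]
  have hkp := sm_iff_isPlot.1 hk
  refine ⟨⟨fun y => op (k y) • q₀ y, hπ.smooth_act hq₀ hkp⟩, ?_, ?_⟩
  · filter_upwards [hlift] with y hy
    rw [← hy]
    exact ((hπ.fibre _ _).2 ⟨k y, rfl⟩).symm
  · funext v
    rw [Θ.gauge m ⟨q₀, hq₀⟩ k hkp, hkx, inv_one, φ.Ad_one, φ.logDeriv_eq_logDer,
      LieChart.logDer, hkx]
    have h2 : (fun y => φ.toFun ((1 : H)⁻¹ * k y)) =ᶠ[𝓝 x]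
        fun y => φ.toFun (φ.invFun (φ.toFun 1 + -A x (y - x))) := by
      filter_upwards [hke] with y hy
      rw [inv_one, one_mul, hy]
    have h3 : dirDeriv (fun y => A x (y - x)) x v = A x v := by
      have h := dirDeriv_comp (f := A x) (g := fun y => y - x) (x := x)
        ((sm_linear (hAo.linear x)).smAt _) (by fun_prop) v
      rw [h, dirDeriv_linear (hAo.linear x), fderiv_sub_const, fderiv_fun_id]
      rfl
    rw [dirDeriv_congr h2, φ.dirDeriv_chart_invFun hξ hξ0, dirDeriv_neg (hξs.smAt x), h3]
    exact add_neg_cancel _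

variable {r : ℕ} {P : MultilinearMap ℝ (fun _ : Fin r => E) ℝ}
  (hπ : IsPrincipalBundle H π) (hP : φ.IsInvariantPolynomial P)

include hπ hP in
theorem polyForm_curv_eq (q q' : Plot Q m) {x : Euc m}
    (h : ∀ᶠ y in 𝓝 x, π (q.1 y) = π (q'.1 y)) :
    polyForm P (φ.curv (Θ.form m q') x) = polyForm P (φ.curv (Θ.form m q) x) := by
  obtain ⟨g, hg⟩ := Θ.exists_curv_eq_Ad hπ q q' h
  rw [hg, hP.polyForm_Ad]

/-- A chosen lift of a plot of the base near a point. -/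
noncomputable def _root_.BaryChernWeil.IsPrincipalBundle.localLift (p : Plot X m) (x : Euc m) :
    Plot Q m :=
  ⟨(hπ.lift p.1 p.2 x).choose, (hπ.lift p.1 p.2 x).choose_spec.1⟩

theorem _root_.BaryChernWeil.IsPrincipalBundle.proj_localLift (p : Plot X m) (x : Euc m) :
    ∀ᶠ y in 𝓝 x, π ((hπ.localLift p x).1 y) = p.1 y :=
  (hπ.lift p.1 p.2 x).choose_spec.2

/-- The value of the Chern-Weil form in a plot. -/
noncomputable def chernWeilPlot (m : ℕ) (p : Plot X m) (x : Euc m) :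
    Euc m [⋀^Fin (2 * r)]→L[ℝ] ℝ :=
  hP.alternating (Θ.isOneForm (hπ.localLift p x)) x

/-- The definition chooses a separate lift for each point. Replacing it by any other lift lets one
smooth lift serve a whole neighbourhood, composites serve pull-backs, and adapted lifts serve
closedness. -/
theorem chernWeilPlot_apply (p : Plot X m) {x : Euc m} (q : Plot Q m)
    (hq : ∀ᶠ y in 𝓝 x, π (q.1 y) = p.1 y) (v : Fin (2 * r) → Euc m) :
    Θ.chernWeilPlot hπ hP m p x v = polyForm P (φ.curv (Θ.form m q) x) v := by
  rw [chernWeilPlot, hP.alternating_apply, Θ.polyForm_curv_eq hπ hP q]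
  filter_upwards [hq, hπ.proj_localLift p x] with y h1 h2
  rw [h1, h2]

/-- The Chern-Weil form of a connection. -/
noncomputable def chernWeil : DForm X (2 * r) :=
  ⟨Θ.chernWeilPlot hπ hP, by
    constructor
    · intro m p
      refine contDiff_alternating fun v => contDiff_iff_contDiffAt.2 fun x => ?_
      have h := hP.contDiff_polyForm (φ.sm_curv (Θ.isOneForm (hπ.localLift p x))) v
      refine h.contDiffAt.congr_of_eventuallyEq ?_
      filter_upwards [(hπ.proj_localLift p x).eventually_nhds] with y hy
      exact Θ.chernWeilPlot_apply hπ hP p _ hy v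
    · intro m k p f hf
      funext x
      ext v
      let q := hπ.localLift p (f x)
      rw [Θ.chernWeilPlot_apply hπ hP ⟨p.1 ∘ f, isPlot_reparam p.2 hf⟩ ⟨q.1 ∘ f, isPlot_reparam q.2 hf⟩
        (hf.continuous.continuousAt.eventually (hπ.proj_localLift p (f x))),
        ContinuousAlternatingMap.compContinuousLinearMap_apply,
        Θ.chernWeilPlot_apply hπ hP p q (hπ.proj_localLift p (f x))]
      have hform : Θ.form k ⟨q.1 ∘ f, isPlot_reparam q.2 hf⟩ =
          fun y u => Θ.form m q (f y) (fderiv ℝ f y u) :=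
        funext fun y => funext fun u => Θ.pullback m k q f hf y u
      have hcurv : φ.curv (Θ.form k ⟨q.1 ∘ f, isPlot_reparam q.2 hf⟩) x =
          fun v w => φ.curv (Θ.form m q) (f x) (fderiv ℝ f x v) (fderiv ℝ f x w) := by
        rw [hform]
        exact funext fun v => funext fun w => φ.curv_pullback (Θ.isOneForm q) hf x v w
      rw [hcurv]
      rfl⟩

theorem chernWeil_apply (p : Plot X m) {x : Euc m} (q : Plot Q m)
    (hq : ∀ᶠ y in 𝓝 x, π (q.1 y) = p.1 y) (v : Fin (2 * r) → Euc m) :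
    (Θ.chernWeil hπ hP).1 m p x v = polyForm P (φ.curv (Θ.form m q) x) v :=
  Θ.chernWeilPlot_apply hπ hP p q hq v

/-- Closedness is checked one point at a time, each with a lift along which the connection form
vanishes at that point. -/
theorem extD_chernWeil : extD X (2 * r) (Θ.chernWeil hπ hP) = 0 := by
  refine DForm.ext_apply fun m p x v => ?_
  change extDeriv ((Θ.chernWeil hπ hP).1 m p) x v = 0
  rw [extDeriv_apply (DForm.differentiable _ m p x)]
  obtain ⟨q, hq, hq0⟩ := Θ.exists_lift_form_eq_zero hπ p x
  rw [← hP.sum_fderiv_polyForm_eq_zero (Θ.isOneForm q) hq0 v]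
  refine Finset.sum_congr rfl fun i _ => ?_
  have he : (fun y => (Θ.chernWeil hπ hP).1 m p y (i.removeNth v)) =ᶠ[𝓝 x]
      fun y => polyForm P (φ.curv (Θ.form m q) y) (i.removeNth v) := by
    filter_upwards [hq.eventually_nhds] with y hy
    exact Θ.chernWeil_apply hπ hP p q hy _
  rw [he.fderiv_eq]
  simp [zsmul_eq_mul]

variable {ι : Type*} (S : LocalSections π ι)

theorem gluesConnection_chernWeil : GluesConnection φ P S Θ (Θ.chernWeil hπ hP) := by
  intro k m p hp hU x v
  exact Θ.chernWeil_apply hπ hP ⟨p, hp⟩ ⟨S.sec k ∘ p, S.smooth_sec k m p hp hU⟩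
    (Filter.Eventually.of_forall fun y => S.proj_sec k _ (hU y)) v

theorem gluesConnection_unique {η η' : DForm X (2 * r)} (h : GluesConnection φ P S Θ η)
    (h' : GluesConnection φ P S Θ η') : η = η' := by
  refine DForm.ext_apply fun m p x v => ?_
  obtain ⟨k, hk⟩ := S.cover (p.1 x)
  have hu : p.1 ⁻¹' S.U k ∈ 𝓝 x :=
    (isOpen_iff_preimages_plots.1 (S.isOpen_U k) m p.1 p.2).mem_nhds hk
  obtain ⟨ρ, hρ, hρx, hρu⟩ := exists_contDiff_eventuallyEq_id hu
  rw [← η.apply_comp_of_eventuallyEq_id p hρ hρx, ← η'.apply_comp_of_eventuallyEq_id p hρ hρx]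
  exact (h k m _ _ hρu x v).trans (h' k m _ _ hρu x v).symm

end Connection

end ChernWeil

/-! ### Fibre integration over the interval and the homotopy formula. -/

section FibreIntegral

variable {V : Type*} [NormedAddCommGroup V] [NormedSpace ℝ V] [FiniteDimensional ℝ V] {n : ℕ}

theorem contDiff_apply_alternating {W : Type*} [NormedAddCommGroup W] [NormedSpace ℝ W]
    {α : W → V [⋀^Fin n]→L[ℝ] ℝ} (hα : ContDiff ℝ ∞ α) (v : Fin n → V) :
    ContDiff ℝ ∞ fun x => α x v :=
  (ContinuousAlternatingMap.apply ℝ V ℝ v).contDiff.comp hα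

/-- Integration over the interval `[0, 1]` of a form on `ℝ × V`. -/
noncomputable def fibreIntegral (α : ℝ × V → (ℝ × V) [⋀^Fin (n + 1)]→L[ℝ] ℝ) (x : V) :
    V [⋀^Fin n]→L[ℝ] ℝ :=
  ∫ t in (0 : ℝ)..1, ((α (t, x)).curryLeft (1, 0)).compContinuousLinearMap
    (ContinuousLinearMap.inr ℝ ℝ V)

variable {α : ℝ × V → (ℝ × V) [⋀^Fin (n + 1)]→L[ℝ] ℝ} (hα : ContDiff ℝ ∞ α)

include hα

theorem contDiff_curryLeft_comp : ContDiff ℝ ∞ fun z : V × ℝ =>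
    ((α (z.2, z.1)).curryLeft (1, 0)).compContinuousLinearMap (ContinuousLinearMap.inr ℝ ℝ V) :=
  contDiff_alternating fun v =>
    (contDiff_apply_alternating hα (Fin.cons (1, 0) fun i => (0, v i))).comp
      (contDiff_snd.prodMk contDiff_fst)

theorem contDiff_fibreIntegral : ContDiff ℝ ∞ (fibreIntegral α) :=
  contDiff_integral_unitInterval (contDiff_curryLeft_comp hα)

theorem fibreIntegral_apply (x : V) (v : Fin n → V) : fibreIntegral α x v =
    ∫ t in (0 : ℝ)..1, α (t, x) (Fin.cons (1, 0) fun i => (0, v i)) := by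
  have h := ContinuousLinearMap.intervalIntegral_comp_comm
    (ContinuousAlternatingMap.apply ℝ V ℝ v) (a := 0) (b := 1)
    (((contDiff_curryLeft_comp hα).continuous.comp
      (by fun_prop : Continuous fun t : ℝ => (x, t))).intervalIntegrable (μ := MeasureTheory.volume)
        _ _)
  exact h.symm

/-- The homotopy formula. -/
theorem extDeriv_fibreIntegral (h0 : ∀ z, extDeriv α z = 0) (x : V) (v : Fin (n + 1) → V) :
    extDeriv (fibreIntegral α) x v =
      α (1, x) (fun i => (0, v i)) - α (0, x) (fun i => (0, v i)) := by
  rw [extDeriv_apply ((contDiff_fibreIntegral hα).differentiable (by simp) x)]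
  let f (u : Fin (n + 1) → ℝ × V) (z : ℝ × V) : ℝ := α z u
  have hf (u) : ContDiff ℝ ∞ (f u) := contDiff_apply_alternating hα u
  have hfd (u) : Continuous fun t : ℝ => fderiv ℝ (f u) (t, x) :=
    ((hf u).continuous_fderiv (by simp)).comp (by fun_prop)
  let c (i : Fin (n + 1)) : Fin (n + 1) → ℝ × V :=
    Fin.cons (1, 0) fun j => (0, i.removeNth v j)
  have h1 (i : Fin (n + 1)) : fderiv ℝ (fun y => fibreIntegral α y (i.removeNth v)) x (v i) =
      ∫ t in (0 : ℝ)..1, fderiv ℝ (f (c i)) (t, x) (0, v i) := by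
    simp only [fibreIntegral_apply hα]
    have hs : ContDiff ℝ ∞ fun z : V × ℝ => f (c i) (z.2, z.1) :=
      (hf _).comp (contDiff_snd.prodMk contDiff_fst)
    have h := hasFDerivAt_integral_unitInterval (hs.of_le (by simp)) x
    have hint : Continuous fun t : ℝ =>
        (fderiv ℝ (fun z : V × ℝ => f (c i) (z.2, z.1)) (x, t)).comp
          (ContinuousLinearMap.inl ℝ V ℝ) :=
      ((hs.continuous_fderiv (by simp)).comp (by fun_prop)).clm_comp continuous_const
    refine (congrArg (fun L : V →L[ℝ] ℝ => L (v i)) h.fderiv).trans ?_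
    rw [ContinuousLinearMap.intervalIntegral_apply (hint.intervalIntegrable _ _)]
    refine intervalIntegral.integral_congr fun t _ => ?_
    have hc : HasFDerivAt (fun z : V × ℝ => f (c i) (z.2, z.1)) ((fderiv ℝ (f (c i)) (t, x)).comp
        ((ContinuousLinearMap.snd ℝ V ℝ).prod (ContinuousLinearMap.fst ℝ V ℝ))) (x, t) :=
      HasFDerivAt.comp (x, t) (g := f (c i)) (f := fun z : V × ℝ => (z.2, z.1))
        ((hf _).differentiable (by simp) _).hasFDerivAt (hasFDerivAt_snd.prodMk hasFDerivAt_fst)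
    simp [hc.fderiv]
  -- This is `dα = 0` evaluated on `∂_t, v_0, …, v_n`: deleting `∂_t` leaves the time derivative,
  -- deleting `v_i` leaves the terms of `d` of the fibre integral with the opposite sign.
  have h2 (t : ℝ) : ∑ i : Fin (n + 1), (-1 : ℝ) ^ (i : ℕ) * fderiv ℝ (f (c i)) (t, x) (0, v i) =
      fderiv ℝ (f fun i => (0, v i)) (t, x) (1, 0) := by
    have h := extDeriv_apply (hα.differentiable (by simp) (t, x))
      (Fin.cons ((1 : ℝ), (0 : V)) fun i => (0, v i))
    rw [h0, Fin.sum_univ_succ] at h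
    have hrem (i : Fin (n + 1)) : i.succ.removeNth (α := fun _ => ℝ × V)
        (Fin.cons ((1 : ℝ), (0 : V)) fun i => (0, v i)) = c i := by
      funext j
      refine Fin.cases ?_ (fun j => ?_) j <;> simp [c, Fin.removeNth]
    have hrem0 : (0 : Fin (n + 2)).removeNth (α := fun _ => ℝ × V)
        (Fin.cons ((1 : ℝ), (0 : V)) fun i => (0, v i)) = fun i => (0, v i) := by
      funext j
      simp [Fin.removeNth]
    simp only [hrem, hrem0, Fin.cons_zero, Fin.cons_succ, Fin.val_zero, pow_zero, one_smul,
      Fin.val_succ, pow_succ, mul_neg, mul_one, neg_smul, Finset.sum_neg_distrib] at h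
    have h' := (sub_eq_zero.1 ((sub_eq_add_neg _ _).trans h.symm)).symm
    rw [← h']
    refine Finset.sum_congr rfl fun i _ => ?_
    simp [zsmul_eq_mul, f]
  have h3 : ∫ t in (0 : ℝ)..1, fderiv ℝ (f fun i => (0, v i)) (t, x) (1, 0) =
      f (fun i => (0, v i)) (1, x) - f (fun i => (0, v i)) (0, x) := by
    refine intervalIntegral.integral_eq_sub_of_hasDerivAt
      (f := fun t => f (fun i => (0, v i)) (t, x)) (fun t _ => ?_) ?_
    · exact HasFDerivAt.comp_hasDerivAt t (l := f fun i => (0, v i))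
        ((hf _).differentiable (by simp) _).hasFDerivAt
        ((hasDerivAt_id t).prodMk (hasDerivAt_const t x))
    · exact ((hfd _).clm_apply continuous_const).intervalIntegrable _ _
  refine Eq.trans ?_ h3
  simp only [← h2]
  rw [intervalIntegral.integral_finsetSum]
  · refine Finset.sum_congr rfl fun i _ => ?_
    rw [h1, intervalIntegral.integral_const_mul]
    simp [zsmul_eq_mul]
  · intro i _
    exact (continuous_const.mul ((hfd _).clm_apply continuous_const)).intervalIntegrable _ _

end FibreIntegral

/-! ### Forms on the cylinder `X × ℝ` and the homotopy operator. -/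

section Cylinder

/-- The cylinder `X × ℝ` with the product diffeology. -/
@[ext]
structure Cylinder (X : Type*) where
  pt : X
  time : ℝ

variable {X : Type*} [DiffeologicalSpace X]

instance : DiffeologicalSpace (Cylinder X) where
  plots m := {p | IsPlot (fun x : Euc m => (p x).pt) ∧ IsPlot fun x : Euc m => (p x).time}
  constant_plots _ := ⟨isPlot_const, isPlot_const⟩
  plot_reparam {n m p f} hp hf :=
    ⟨isPlot_reparam (p := fun x => (p x).pt) hp.1 hf,
      isPlot_reparam (p := fun x => (p x).time) hp.2 hf⟩
  locality {n p} hp := by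
    refine ⟨DiffeologicalSpace.locality fun x => ?_, DiffeologicalSpace.locality fun x => ?_⟩
    · obtain ⟨u, hu, hxu, h⟩ := hp x
      exact ⟨u, hu, hxu, fun hf hf' => (h hf hf').1⟩
    · obtain ⟨u, hu, hxu, h⟩ := hp x
      exact ⟨u, hu, hxu, fun hf hf' => (h hf hf').2⟩

/-- A parametrised piece of the cylinder over a plot. -/
def Plot.cylinder {m k : ℕ} (p : Plot X m) {g : Euc k → ℝ × Euc m} (hg : ContDiff ℝ ∞ g) :
    Plot (Cylinder X) k :=
  ⟨fun y => ⟨p.1 (g y).2, (g y).1⟩, isPlot_reparam p.2 hg.snd, hg.fst.isPlot⟩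

/-- The slice of the cylinder at time `s` over a plot. -/
def Plot.slice {m : ℕ} (p : Plot X m) (s : ℝ) : Plot (Cylinder X) m :=
  ⟨fun y => ⟨p.1 y, s⟩, p.2, isPlot_const⟩

/-- Coordinates splitting off a time parameter. -/
noncomputable def eucSuccEquiv (m : ℕ) : Euc (m + 1) ≃L[ℝ] ℝ × Euc m :=
  ContinuousLinearEquiv.ofFinrankEq (by simp [add_comm])

variable {n : ℕ} (α : DForm (Cylinder X) n)

/-- The pull-back of a form on the cylinder to the cylinder over the domain of a plot. -/
noncomputable def cylinderForm {m : ℕ} (p : Plot X m) (z : ℝ × Euc m) :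
    (ℝ × Euc m) [⋀^Fin n]→L[ℝ] ℝ :=
  (α.1 (m + 1) (p.cylinder (eucSuccEquiv m).contDiff)
    ((eucSuccEquiv m).symm z)).compContinuousLinearMap (eucSuccEquiv m).symm

theorem contDiff_cylinderForm {m : ℕ} (p : Plot X m) : ContDiff ℝ ∞ (cylinderForm α p) :=
  contDiff_alternating fun v => contDiff_apply_alternating
    ((α.2.1 _ _).comp (eucSuccEquiv m).symm.contDiff) fun i => (eucSuccEquiv m).symm (v i)

/-- Forms are given only on plots with domain some `Euc k`, so `ℝ × Euc m` is reached through a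
linear isomorphism with `Euc (m + 1)`. Naturality shows that every parametrised piece of the
cylinder sees the same form. -/
theorem apply_cylinder {m k : ℕ} (p : Plot X m) {g : Euc k → ℝ × Euc m} (hg : ContDiff ℝ ∞ g)
    (y : Euc k) (v : Fin n → Euc k) :
    α.1 k (p.cylinder hg) y v = cylinderForm α p (g y) fun i => fderiv ℝ g y (v i) := by
  let e := eucSuccEquiv m
  have h := α.2.2 (m + 1) k (p.cylinder e.contDiff) (fun y => e.symm (g y))
    (e.symm.contDiff.comp hg)
  have hp : (⟨(p.cylinder e.contDiff).1 ∘ fun y => e.symm (g y),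
      isPlot_reparam (p.cylinder e.contDiff).2 (e.symm.contDiff.comp hg)⟩ : Plot (Cylinder X) k) =
      p.cylinder hg := Subtype.ext (funext fun y => by simp [Plot.cylinder])
  rw [hp] at h
  have hd : fderiv ℝ (fun y => e.symm (g y)) y = (e.symm : _ →L[ℝ] _).comp (fderiv ℝ g y) :=
    (e.symm.toContinuousLinearMap.hasFDerivAt.comp y
      (hg.differentiable (by simp) y).hasFDerivAt).fderiv
  refine (congrArg (fun β => β y v) h).trans ?_
  beta_reduce
  rw [hd]
  rfl

theorem apply_slice {m : ℕ} (p : Plot X m) (s : ℝ) (x : Euc m) (v : Fin n → Euc m) :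
    α.1 m (p.slice s) x v = cylinderForm α p (s, x) fun i => (0, v i) := by
  have hg : ContDiff ℝ ∞ fun y : Euc m => (s, y) := by fun_prop
  refine (apply_cylinder α p hg x v).trans ?_
  rw [(hasFDerivAt_prodMk_right s x).fderiv]
  rfl

theorem cylinderForm_comp {m k : ℕ} (p : Plot X m) {f : Euc k → Euc m} (hf : ContDiff ℝ ∞ f)
    (t : ℝ) (x : Euc k) (v : Fin n → ℝ × Euc k) :
    cylinderForm α ⟨p.1 ∘ f, isPlot_reparam p.2 hf⟩ (t, x) v =
      cylinderForm α p (t, f x) fun i => ((v i).1, fderiv ℝ f x (v i).2) := by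
  let e := eucSuccEquiv k
  have hF : HasFDerivAt (fun z : ℝ × Euc k => (z.1, f z.2))
      ((ContinuousLinearMap.fst ℝ ℝ (Euc k)).prod
        ((fderiv ℝ f x).comp (ContinuousLinearMap.snd ℝ ℝ (Euc k)))) (t, x) :=
    hasFDerivAt_fst.prodMk (HasFDerivAt.comp (t, x) (g := f)
      (hf.differentiable (by simp) x).hasFDerivAt hasFDerivAt_snd)
  have hg : ContDiff ℝ ∞ fun y => ((e y).1, f (e y).2) :=
    e.contDiff.fst.prodMk (hf.comp e.contDiff.snd)
  refine (apply_cylinder α p hg (e.symm (t, x)) fun i => e.symm (v i)).trans ?_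
  have hd : HasFDerivAt (fun y => ((e y).1, f (e y).2)) _ (e.symm (t, x)) :=
    HasFDerivAt.comp (e.symm (t, x)) (g := fun z : ℝ × Euc k => (z.1, f z.2)) (f := e)
      (by rw [e.apply_symm_apply]; exact hF) e.toContinuousLinearMap.hasFDerivAt
  rw [hd.fderiv]
  simp

theorem extDeriv_cylinderForm (hα : extD (Cylinder X) n α = 0) {m : ℕ} (p : Plot X m)
    (z : ℝ × Euc m) : extDeriv (cylinderForm α p) z = 0 := by
  let e := eucSuccEquiv m
  let c := p.cylinder e.contDiff
  have h1 : cylinderForm α p = fun z =>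
      (α.1 (m + 1) c (e.symm z)).compContinuousLinearMap (fderiv ℝ e.symm z) := by
    funext z
    rw [e.symm.fderiv]
    rfl
  have h2 : extDeriv (α.1 (m + 1) c) (e.symm z) = 0 := by
    change (extD (Cylinder X) n α).1 (m + 1) c (e.symm z) = 0
    rw [hα]
    rfl
  rw [h1, extDeriv_pullback (r := ∞) (DForm.differentiable α _ c _) e.symm.contDiff.contDiffAt (by
    rw [minSmoothness_of_isRCLikeNormedField]
    exact WithTop.coe_le_coe.2 (le_top (a := (2 : ℕ∞)))), h2]
  rfl

/-- The homotopy operator. -/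
noncomputable def homotopyOperator (α : DForm (Cylinder X) (n + 1)) : DForm X n :=
  ⟨fun _ p => fibreIntegral (cylinderForm α p), by
    refine ⟨fun m p => contDiff_fibreIntegral (contDiff_cylinderForm α p), fun m k p f hf => ?_⟩
    funext x
    ext v
    rw [fibreIntegral_apply (contDiff_cylinderForm α _),
      ContinuousAlternatingMap.compContinuousLinearMap_apply,
      fibreIntegral_apply (contDiff_cylinderForm α _)]
    refine intervalIntegral.integral_congr fun t _ => ?_
    refine (cylinderForm_comp α p hf t x _).trans (congrArg _ (funext fun i => ?_))
    refine Fin.cases ?_ (fun i => ?_) i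
    · simp
    · simp⟩

theorem extD_homotopyOperator (α : DForm (Cylinder X) (n + 1))
    (hα : extD (Cylinder X) (n + 1) α = 0) {m : ℕ} (p : Plot X m) (x : Euc m)
    (v : Fin (n + 1) → Euc m) : (extD X n (homotopyOperator α)).1 m p x v =
      α.1 m (p.slice 1) x v - α.1 m (p.slice 0) x v := by
  rw [apply_slice, apply_slice]
  exact extDeriv_fibreIntegral (contDiff_cylinderForm α p) (extDeriv_cylinderForm α hα p) x v

/-- The homotopy operator yields the primitive. Degree 0 is excluded because there only zero is
exact. -/
theorem sub_mem_exactForms (hn : n ≠ 0) (hα : extD (Cylinder X) n α = 0) {η₀ η₁ : DForm X n}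
    (h0 : ∀ m p x v, η₀.1 m p x v = α.1 m (Plot.slice p 0) x v)
    (h1 : ∀ m p x v, η₁.1 m p x v = α.1 m (Plot.slice p 1) x v) : η₁ - η₀ ∈ exactForms X n := by
  obtain ⟨n, rfl⟩ := Nat.exists_eq_succ_of_ne_zero hn
  refine ⟨homotopyOperator α, DForm.ext_apply fun m p x v => ?_⟩
  rw [extD_homotopyOperator α hα, ← h0, ← h1]
  rfl

end Cylinder

/-! ### The affine path of connections and independence of the connection. -/

section CylinderBundle

open MulOpposite

variable {X Q H E : Type*} [DiffeologicalSpace X] [DiffeologicalSpace Q]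
  [Group H] [DiffeologicalSpace H] [DiffeologicalGroup H] [MulAction Hᵐᵒᵖ Q]
  [AddCommGroup E] [Module ℝ E] [DiffeologicalSpace E] [ConvenientSpace E]
  {φ : LieChart H E} {π : Q → X}

instance : MulAction Hᵐᵒᵖ (Cylinder Q) where
  smul h q := ⟨h • q.pt, q.time⟩
  one_smul q := Cylinder.ext (one_smul _ q.pt) rfl
  mul_smul g h q := Cylinder.ext (mul_smul g h q.pt) rfl

/-- The projection of the cylinder over a bundle. -/
def cylinderProj (π : Q → X) (q : Cylinder Q) : Cylinder X := ⟨π q.pt, q.time⟩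

theorem IsPrincipalBundle.cylinder (hπ : IsPrincipalBundle H π) :
    IsPrincipalBundle H (cylinderProj π) where
  smooth_proj n p hp := ⟨hπ.smooth_proj n _ hp.1, hp.2⟩
  smooth_act hq hh := ⟨hπ.smooth_act hq.1 hh, hq.2⟩
  fibre q q' := by
    constructor
    · intro h
      obtain ⟨g, hg⟩ := (hπ.fibre q.pt q'.pt).1 (congrArg Cylinder.pt h)
      exact ⟨g, Cylinder.ext hg (congrArg Cylinder.time h).symm⟩
    · rintro ⟨g, rfl⟩
      exact Cylinder.ext ((hπ.fibre q.pt _).2 ⟨g, rfl⟩) rfl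
  free q h hh := hπ.free q.pt h (congrArg Cylinder.pt hh)
  smooth_div hq hqh := hπ.smooth_div hq.1 hqh.1
  lift p hp x := by
    obtain ⟨q, hq, hqx⟩ := hπ.lift _ hp.1 x
    exact ⟨fun y => ⟨q y, (p y).time⟩, ⟨hq, hp.2⟩, hqx.mono fun y hy => Cylinder.ext hy rfl⟩

/-- The underlying plot of a plot of the cylinder. -/
def Plot.pt {m : ℕ} (q : Plot (Cylinder Q) m) : Plot Q m := ⟨fun y => (q.1 y).pt, q.2.1⟩

namespace Connection

variable (Θ₀ Θ₁ : Connection φ Q)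

/-- The affine homotopy between two connections, as a connection on the cylinder. -/
def homotopy : Connection φ (Cylinder Q) where
  form m q x v := (1 - (q.1 x).time) • Θ₀.form m q.pt x v + (q.1 x).time • Θ₁.form m q.pt x v
  linear m q x := by
    refine ⟨fun v w => ?_, fun c v => ?_⟩
    · rw [(Θ₀.linear _ _ _).map_add, (Θ₁.linear _ _ _).map_add]
      module
    · rw [(Θ₀.linear _ _ _).map_smul, (Θ₁.linear _ _ _).map_smul]
      module
  smooth m q v := by
    have ht : Sm fun x => (q.1 x).time := sm_iff_isPlot.2 q.2.2
    have ht' : Sm fun x => 1 - (q.1 x).time :=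
      sm_iff_contDiff.2 (contDiff_const.sub (sm_iff_contDiff.1 ht))
    exact sm_iff_isPlot.1 (sm_of_smAt fun x => smAt_add
      (smAt_smul (ht'.smAt x) (((Θ₀.isOneForm q.pt).sm v).smAt x))
      (smAt_smul (ht.smAt x) (((Θ₁.isOneForm q.pt).sm v).smAt x)))
  pullback m k q f hf x v :=
    congrArg₂ (fun ξ η => (1 - (q.1 (f x)).time) • ξ + (q.1 (f x)).time • η)
      (Θ₀.pullback m k q.pt f hf x v) (Θ₁.pullback m k q.pt f hf x v)
  gauge m q h hh hq x v := by
    refine (congrArg₂ (fun ξ η => (1 - (q.1 x).time) • ξ + (q.1 x).time • η)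
      (Θ₀.gauge m q.pt h hh hq.1 x v) (Θ₁.gauge m q.pt h hh hq.1 x v)).trans ?_
    -- The coefficients `1 - t` and `t` sum to 1, so the two copies of `h⁻¹dh` combine into exactly
    -- one.
    rw [φ.Ad_add, φ.Ad_smul, φ.Ad_smul]
    module

variable {r : ℕ} {P : MultilinearMap ℝ (fun _ : Fin r => E) ℝ}
  (hπ : IsPrincipalBundle H π) (hP : φ.IsInvariantPolynomial P)

theorem chernWeil_slice {s : ℝ} {Θ : Connection φ Q}
    (hs : ∀ m (q : Plot Q m), (Θ₀.homotopy Θ₁).form m (q.slice s) = Θ.form m q) (m : ℕ)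
    (p : Plot X m) (x : Euc m) (v : Fin (2 * r) → Euc m) :
    (Θ.chernWeil hπ hP).1 m p x v =
      ((Θ₀.homotopy Θ₁).chernWeil hπ.cylinder hP).1 m (p.slice s) x v := by
  have hl := hπ.proj_localLift p x
  rw [Θ.chernWeil_apply hπ hP p _ hl, (Θ₀.homotopy Θ₁).chernWeil_apply hπ.cylinder hP (p.slice s)
    ((hπ.localLift p x).slice s) (hl.mono fun y hy => Cylinder.ext hy rfl), hs]

/-- The Chern-Weil forms of two connections are cohomologous. -/
theorem chernWeil_sub_mem_exactForms :
    Θ₁.chernWeil hπ hP - Θ₀.chernWeil hπ hP ∈ exactForms X (2 * r) := by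
  by_cases hr : r = 0
  -- In degree 0 the forms must be equal, and they are: `P` is then evaluated on the empty family.
  · subst hr
    have : Θ₁.chernWeil hπ hP = Θ₀.chernWeil hπ hP := DForm.ext_apply fun m p x v => by
      have hl := hπ.proj_localLift p x
      rw [Θ₁.chernWeil_apply hπ hP p _ hl, Θ₀.chernWeil_apply hπ hP p _ hl]
      simp only [polyForm]
      congr 1
      refine Finset.sum_congr rfl fun τ _ => ?_
      congr 2
      exact Subsingleton.elim _ _
    rw [this, sub_self]
    exact Submodule.zero_mem _
  · refine sub_mem_exactForms ((Θ₀.homotopy Θ₁).chernWeil hπ.cylinder hP) (by omega)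
      ((Θ₀.homotopy Θ₁).extD_chernWeil hπ.cylinder hP)
      (Θ₀.chernWeil_slice Θ₁ hπ hP fun m q => ?_) (Θ₀.chernWeil_slice Θ₁ hπ hP fun m q => ?_)
    · funext x v
      change (1 - (0 : ℝ)) • Θ₀.form m q x v + (0 : ℝ) • Θ₁.form m q x v = _
      simp
    · funext x v
      change (1 - (1 : ℝ)) • Θ₀.form m q x v + (1 : ℝ) • Θ₁.form m q x v = _
      simp

end Connection

end CylinderBundle

/-! ### The barycentric connection. -/

section Barycentric

open MulOpposite

variable {X Q H E : Type*} [DiffeologicalSpace X] [DiffeologicalSpace Q]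
  [Group H] [DiffeologicalSpace H] [DiffeologicalGroup H] [MulAction Hᵐᵒᵖ Q]
  [AddCommGroup E] [Module ℝ E] [DiffeologicalSpace E] [ConvenientSpace E]
  {φ : LieChart H E} {π : Q → X} (hπ : IsPrincipalBundle H π) {ι : Type*}
  (T : NumerableSections π ι) {m : ℕ}

include hπ in
theorem IsPrincipalBundle.transition_spec {q q' : Q} (h : π q = π q') :
    q' = op (transition H q q') • q :=
  Classical.epsilon_spec ((hπ.fibre q q').1 h)

include hπ in
theorem IsPrincipalBundle.smul_injective {q : Q} {g h : H} (e : op g • q = op h • q) : g = h := by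
  have h1 : op (g * h⁻¹) • q = q := by
    rw [op_mul, mul_smul, e, ← mul_smul, ← op_mul, mul_inv_cancel, op_one, one_smul]
  exact mul_inv_eq_one.1 (hπ.free q _ h1)

include hπ in
theorem IsPrincipalBundle.transition_smul {q q' : Q} (h : π q = π q') (g : H) :
    transition H q (op g • q') = transition H q q' * g := by
  refine hπ.smul_injective (q := q) ?_
  have h2 : π q = π (op g • q') := h.trans ((hπ.fibre q' _).2 ⟨g, rfl⟩)
  rw [← hπ.transition_spec h2, op_mul, mul_smul, ← hπ.transition_spec h]

include hπ in
theorem IsPrincipalBundle.isPlot_proj (q : Plot Q m) : IsPlot fun y => π (q.1 y) :=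
  hπ.smooth_proj m q.1 q.2

namespace NumerableSections

include hπ in
-- Division in the fibres is smooth, but the section is smooth only over `U i`, so the plot is first
-- squeezed into it.
theorem smAt_transition (q : Plot Q m) {x : Euc m} {i : ι} (hx : π (q.1 x) ∈ T.U i) :
    SmAt (fun y => transition H (T.sec i (π (q.1 y))) (q.1 y)) x := by
  have hp := hπ.isPlot_proj q
  have hu : {y | π (q.1 y) ∈ T.U i} ∈ 𝓝 x :=
    (isOpen_iff_preimages_plots.1 (T.isOpen_U i) m _ hp).mem_nhds hx
  obtain ⟨ρ, hρ, hρx, hρu⟩ := exists_contDiff_eventuallyEq_id hu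
  have hs : IsPlot fun y => T.sec i (π (q.1 (ρ y))) :=
    T.smooth_sec i m _ (isPlot_reparam hp hρ) hρu
  have he : (fun y => op (transition H (T.sec i (π (q.1 (ρ y)))) (q.1 (ρ y))) •
      T.sec i (π (q.1 (ρ y)))) = q.1 ∘ ρ :=
    funext fun y => (hπ.transition_spec (T.proj_sec i _ (hρu y))).symm
  have hk := hπ.smooth_div hs (he ▸ isPlot_reparam q.2 hρ)
  refine ⟨_, sm_iff_isPlot.2 hk, ?_⟩
  filter_upwards [hρx] with y hy
  rw [hy, id]

theorem mem_of_lam_ne_zero {i : ι} {a : X} (h : T.lam i a ≠ 0) : a ∈ T.U i :=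
  T.lam_supp i (@subset_closure X dTopology _ a h)

include hπ in
theorem exists_finset (q : Plot Q m) (x : Euc m) :
    ∃ s : Finset ι, ∀ᶠ y in 𝓝 x, ∀ i, T.lam i (π (q.1 y)) ≠ 0 → i ∈ s := by
  obtain ⟨t, ht, hfin⟩ := T.locallyFinite (π (q.1 x))
  obtain ⟨u, hut, hu, hxu⟩ := (@mem_nhds_iff X dTopology (π (q.1 x)) t).1 ht
  refine ⟨hfin.toFinset, ?_⟩
  have hev : {y | π (q.1 y) ∈ u} ∈ 𝓝 x :=
    (isOpen_iff_preimages_plots.1 hu m _ (hπ.isPlot_proj q)).mem_nhds hxu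
  filter_upwards [hev] with y hy i hi
  exact hfin.mem_toFinset.2 ⟨_, T.mem_of_lam_ne_zero hi, hut hy⟩

/-- The contribution of one local section to the barycentric connection. -/
noncomputable def term (φ : LieChart H E) (q : Plot Q m) (x v : Euc m) (i : ι) : E :=
  T.lam i (π (q.1 x)) • φ.logDer (fun y => transition H (T.sec i (π (q.1 y))) (q.1 y)) x v

theorem term_eq_zero (q : Plot Q m) {x : Euc m} {i : ι} (h : T.lam i (π (q.1 x)) = 0)
    (v : Euc m) : T.term φ q x v i = 0 := by
  rw [term, h, zero_smul]

theorem finsum_term (q : Plot Q m) {x : Euc m} {s : Finset ι}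
    (hs : ∀ i, T.lam i (π (q.1 x)) ≠ 0 → i ∈ s) (v : Euc m) :
    ∑ᶠ i, T.term φ q x v i = ∑ i ∈ s, T.term φ q x v i :=
  finsum_eq_sum_of_support_subset _ fun i hi => hs i fun h => hi (T.term_eq_zero q h v)

include hπ in
-- Over `U i` all ingredients are smooth. Elsewhere the base point avoids the closed support of the
-- weight, so the term vanishes identically nearby.
theorem smAt_term (q : Plot Q m) (x v : Euc m) (i : ι) : SmAt (fun y => T.term φ q y v i) x := by
  have hp := sm_iff_isPlot.2 (hπ.isPlot_proj q)
  by_cases hx : π (q.1 x) ∈ T.U i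
  · exact smAt_smul ((hp.smAt x).dSmooth_comp (T.smooth_lam i))
      (φ.smAt_logDer (T.smAt_transition hπ q hx) v)
  · have hU : IsOpen[dTopology] (@closure X dTopology (Function.support (T.lam i)))ᶜ :=
      (@isClosed_closure X dTopology _).isOpen_compl
    refine (smAt_const (0 : E) x).congr ?_
    filter_upwards [(hp.smAt x).eventually_mem hU fun h => hx (T.lam_supp i h)] with y hy
    refine (T.term_eq_zero q ?_ v).symm
    by_contra h
    exact hy (@subset_closure X dTopology _ _ h)

/-- The barycentric connection. -/
noncomputable def connection (φ : LieChart H E) : Connection φ Q where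
  form _ q x v := ∑ᶠ i, T.term φ q x v i
  linear m q x := by
    obtain ⟨s, hs⟩ := T.exists_finset hπ q x
    refine ⟨fun v w => ?_, fun c v => ?_⟩
    · simp only [T.finsum_term q hs.self_of_nhds, ← Finset.sum_add_distrib]
      refine Finset.sum_congr rfl fun i _ => ?_
      -- Outside `U i` the transition function is a meaningless choice; a nonzero weight places the
      -- point in `U i`, where it is smooth.
      by_cases h : T.lam i (π (q.1 x)) = 0
      · simp [T.term_eq_zero q h]
      · rw [term, φ.logDer_add (T.smAt_transition hπ q (T.mem_of_lam_ne_zero h)), smul_add]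
        rfl
    · simp only [T.finsum_term q hs.self_of_nhds, Finset.smul_sum]
      refine Finset.sum_congr rfl fun i _ => ?_
      by_cases h : T.lam i (π (q.1 x)) = 0
      · simp [T.term_eq_zero q h]
      · rw [term, φ.logDer_smul (T.smAt_transition hπ q (T.mem_of_lam_ne_zero h)), smul_comm]
        rfl
  smooth m q v := by
    refine sm_iff_isPlot.1 (sm_of_smAt fun x => ?_)
    obtain ⟨s, hs⟩ := T.exists_finset hπ q x
    refine (smAt_sum s fun i _ => T.smAt_term (φ := φ) hπ q x v i).congr ?_
    exact hs.mono fun y hy => (T.finsum_term q hy v).symm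
  pullback m k q f hf x v := by
    refine finsum_congr fun i => ?_
    by_cases h : T.lam i (π (q.1 (f x))) = 0
    · exact (T.term_eq_zero ⟨q.1 ∘ f, isPlot_reparam q.2 hf⟩ h v).trans
        (T.term_eq_zero q h _).symm
    · exact congrArg _ (φ.logDer_comp
        (T.smAt_transition hπ q (T.mem_of_lam_ne_zero h)) hf v)
  gauge m q h hh hq x v := by
    obtain ⟨s, hs⟩ := T.exists_finset hπ q x
    have hproj (y : Euc m) : π (op (h y) • q.1 y) = π (q.1 y) :=
      ((hπ.fibre _ _).2 ⟨h y, rfl⟩).symm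
    have hsum : ∑ i ∈ s, T.lam i (π (q.1 x)) = 1 := by
      rw [← T.lam_sum (π (q.1 x))]
      exact (finsum_eq_sum_of_support_subset _ fun i hi => hs.self_of_nhds i hi).symm
    have hs' : ∀ i, T.lam i (π (op (h x) • q.1 x)) ≠ 0 → i ∈ s := by
      rw [hproj]
      exact hs.self_of_nhds
    -- Each term obeys the gauge rule with its inhomogeneous part scaled by `λ_i`; summing, the
    -- weights add up to 1.
    have hterm (i : ι) : T.term φ ⟨fun y => op (h y) • q.1 y, hq⟩ x v i =
        φ.Ad (h x)⁻¹ (T.term φ q x v i) + T.lam i (π (q.1 x)) • φ.logDer h x v := by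
      simp only [term, hproj]
      by_cases h0 : T.lam i (π (q.1 x)) = 0
      · simpa [h0] using (φ.Ad_smul (h x)⁻¹ 0 0).symm
      · have hx := T.mem_of_lam_ne_zero h0
        have hev : ∀ᶠ y in 𝓝 x, π (q.1 y) ∈ T.U i :=
          (isOpen_iff_preimages_plots.1 (T.isOpen_U i) m _ (hπ.isPlot_proj q)).mem_nhds hx
        have he : (fun y => transition H (T.sec i (π (q.1 y))) (op (h y) • q.1 y)) =ᶠ[𝓝 x]
            fun y => transition H (T.sec i (π (q.1 y))) (q.1 y) * h y :=
          hev.mono fun y hy => hπ.transition_smul (T.proj_sec i _ hy) (h y)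
        rw [φ.logDer_congr he, φ.logDer_mul (T.smAt_transition hπ q hx)
          ((sm_iff_isPlot.2 hh).smAt x), smul_add, φ.Ad_smul]
    rw [T.finsum_term _ hs', T.finsum_term q hs.self_of_nhds, φ.logDeriv_eq_logDer]
    simp only [hterm, Finset.sum_add_distrib, ← Finset.sum_smul, hsum, one_smul]
    congr 1
    exact (map_sum (φ.AdLinear (h x)⁻¹) _ s).symm

theorem localForm_connection (φ : LieChart H E) (k : ι) (p : Euc m → X) (hp : IsPlot p)
    (hU : ∀ x, p x ∈ T.U k) :
    (T.connection hπ φ).localForm T.toLocalSections k p hp hU = baryForm φ T k p := by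
  funext x v
  have h (y : Euc m) : π (T.sec k (p y)) = p y := T.proj_sec k _ (hU y)
  change ∑ᶠ i, T.lam i (π (T.sec k (p x))) • φ.logDeriv
    (fun y => transition H (T.sec i (π (T.sec k (p y)))) (T.sec k (p y))) x v = _
  simp only [h]
  rfl

theorem gluesBary_iff (φ : LieChart H E) {r : ℕ} (P : MultilinearMap ℝ (fun _ : Fin r => E) ℝ)
    (η : DForm X (2 * r)) : GluesBary φ P T η ↔
      GluesConnection φ P T.toLocalSections (T.connection hπ φ) η := by
  refine forall₄_congr fun k m p hp => forall_congr' fun hU => ?_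
  rw [T.localForm_connection hπ φ k p hp hU]

end NumerableSections

end Barycentric

/-! ### The common de Rham class. -/

section Classes

variable {X Q H E : Type*} [DiffeologicalSpace X] [DiffeologicalSpace Q]
  [Group H] [DiffeologicalSpace H] [DiffeologicalGroup H] [MulAction Hᵐᵒᵖ Q]
  [AddCommGroup E] [Module ℝ E] [DiffeologicalSpace E] [ConvenientSpace E]
  {φ : LieChart H E} {π : Q → X} (hπ : IsPrincipalBundle H π)
  {r : ℕ} {P : MultilinearMap ℝ (fun _ : Fin r => E) ℝ} (hP : φ.IsInvariantPolynomial P)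

/-- The Chern-Weil form of a connection, as a closed form. -/
noncomputable def Connection.closedChernWeil (Θ : Connection φ Q) : closedForms X (2 * r) :=
  ⟨Θ.chernWeil hπ hP, LinearMap.mem_ker.2 (Θ.extD_chernWeil hπ hP)⟩

theorem Connection.deRhamClass_eq (Θ₀ Θ₁ : Connection φ Q) :
    deRhamClass (Θ₁.closedChernWeil hπ hP) = deRhamClass (Θ₀.closedChernWeil hπ hP) :=
  (Submodule.Quotient.eq _).2 (Θ₀.chernWeil_sub_mem_exactForms Θ₁ hπ hP)

include hπ hP in
theorem exists_deRhamClass : ∃ c : DeRham X (2 * r), ∀ Θ : Connection φ Q,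
    deRhamClass (Θ.closedChernWeil hπ hP) = c := by
  by_cases h : Nonempty (Connection φ Q)
  · obtain ⟨Θ₀⟩ := h
    exact ⟨_, fun Θ => Θ₀.deRhamClass_eq hπ hP Θ⟩
  -- Without any connection the condition on the class is empty.
  · exact ⟨0, fun Θ => (h ⟨Θ⟩).elim⟩

end Classes

/-! ### The semidirect product as a diffeological group. -/

section Semidirect

variable {G : Type*} [Group G] [DiffeologicalSpace G] [DiffeologicalGroup G]

/-- The sign of a plot is locally constant, so near each point the twist in the product is by one
fixed smooth automorphism. -/
theorem diffeologicalGroup_semidirect (σ : ℤˣ →* MulAut G) (hσ : ∀ ε, DSmooth (σ ε)) :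
    DiffeologicalGroup (G ⋊[σ] ℤˣ) := by
  have key {m : ℕ} {p : Euc m → G} {ε : Euc m → ℤˣ} (hp : IsPlot p) (hε : IsLocallyConstant ε) :
      IsPlot fun x => σ (ε x) (p x) := by
    refine sm_iff_isPlot.1 (sm_of_smAt fun x => ?_)
    refine (((sm_iff_isPlot.2 hp).smAt x).dSmooth_comp (hσ (ε x))).congr ?_
    filter_upwards [(IsLocallyConstant.iff_eventually_eq ε).1 hε x] with y hy
    rw [hy]
  constructor
  · intro m p q hp hq
    exact ⟨DiffeologicalGroup.mul_plot hp.1 (key hq.1 hp.2), hp.2.mul hq.2⟩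
  · intro m p hp
    exact ⟨key (DiffeologicalGroup.inv_plot hp.1) hp.2.inv, hp.2.inv⟩

end Semidirect

end BaryChernWeil

theorem mainTheorem10
    {X Q G E : Type*} [DiffeologicalSpace X] [DiffeologicalSpace Q]
    [Group G] [DiffeologicalSpace G] [BaryChernWeil.DiffeologicalGroup G]
    [AddCommGroup E] [Module ℝ E] [DiffeologicalSpace E] [BaryChernWeil.ConvenientSpace E]
    (φ : BaryChernWeil.LieChart G E)
    (σ : ℤˣ →* MulAut G) (hσ : ∀ ε, Diffeology.DSmooth (σ ε))
    [MulAction (G ⋊[σ] ℤˣ)ᵐᵒᵖ Q]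
    (π : Q → X) (hπ : BaryChernWeil.IsPrincipalBundle (G ⋊[σ] ℤˣ) π)
    {r : ℕ} (P : MultilinearMap ℝ (fun _ : Fin r => E) ℝ)
    (hP : (φ.semidirect σ).IsInvariantPolynomial P) :
    -- the barycentric local forms are the local forms of a connection
    (∀ (ι : Type*) (T : BaryChernWeil.NumerableSections π ι),
      ∃ Θ : BaryChernWeil.Connection (φ.semidirect σ) Q,
        ∀ (k : ι) (m : ℕ) (p : BaryChernWeil.Euc m → X) (hp : Diffeology.IsPlot p)
          (hU : ∀ x, p x ∈ T.U k),
          Θ.localForm T.toLocalSections k p hp hU =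
            BaryChernWeil.baryForm (φ.semidirect σ) T k p) ∧
    -- one and the same de Rham class is obtained from all choices
    ∃ c : BaryChernWeil.DeRham X (2 * r),
      (∀ (ι : Type*) (T : BaryChernWeil.NumerableSections π ι),
        ∃ η : BaryChernWeil.closedForms X (2 * r),
          BaryChernWeil.GluesBary (φ.semidirect σ) P T η.1 ∧
          (∀ η' : BaryChernWeil.DForm X (2 * r),
            BaryChernWeil.GluesBary (φ.semidirect σ) P T η' → η' = η.1) ∧
          BaryChernWeil.deRhamClass η = c) ∧
      (∀ (Θ : BaryChernWeil.Connection (φ.semidirect σ) Q)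
        (ι : Type*) (S : BaryChernWeil.LocalSections π ι),
        ∃ η : BaryChernWeil.closedForms X (2 * r),
          BaryChernWeil.GluesConnection (φ.semidirect σ) P S Θ η.1 ∧
          (∀ η' : BaryChernWeil.DForm X (2 * r),
            BaryChernWeil.GluesConnection (φ.semidirect σ) P S Θ η' → η' = η.1) ∧
          BaryChernWeil.deRhamClass η = c) := by
  have := BaryChernWeil.diffeologicalGroup_semidirect σ hσ
  -- The class is fixed before any cover, section, partition or connection; the barycentric data
  -- then enter only through their connection.
  obtain ⟨c, hc⟩ := BaryChernWeil.exists_deRhamClass hπ hP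
  refine ⟨fun ι T => ⟨T.connection hπ _, fun k m p hp hU => T.localForm_connection hπ _ k p hp hU⟩,
    c, fun ι T => ?_, fun Θ ι S => ?_⟩
  · let Θ := T.connection hπ (φ.semidirect σ)
    refine ⟨Θ.closedChernWeil hπ hP, ?_, fun η' h => ?_, hc Θ⟩
    · exact (T.gluesBary_iff hπ _ P _).2 (Θ.gluesConnection_chernWeil hπ hP T.toLocalSections)
    · exact Θ.gluesConnection_unique T.toLocalSections ((T.gluesBary_iff hπ _ P _).1 h)
        (Θ.gluesConnection_chernWeil hπ hP T.toLocalSections)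
  · exact ⟨Θ.closedChernWeil hπ hP, Θ.gluesConnection_chernWeil hπ hP S,
      fun η' h => Θ.gluesConnection_unique S h (Θ.gluesConnection_chernWeil hπ hP S), hc Θ⟩
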